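/- For a finite simple graph $G$ on $n\ge 1$ vertices, call $G$ a Dirac graph if its minimum degree is at least $n/2$; let $h(G)$ denote the number of distinct Hamilton cycles of $G$ (cycles through all vertices, counted as subgraphs, without base point or orientation); and let $\mathrm{reg}(G)$ denote the largest even integer $r\ge 0$ such that $G$ has an $r$-factor, i.e. an $r$-regular spanning subgraph. **Proposition.** There is a sequence of real numbers $(\varepsilon_n)_{n\ge 0}$ with $\varepsilon_n\to 0$ as $n\to\infty$ such that for every $n\ge 1$ and every Dirac graph $G$ on $n$ vertices $$h(G)\;\ge\;\left(\frac{\mathrm{reg}(G)}{e}\right)^{n}(1-\varepsilon_n)^{n}.$$ -/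

import Mathlib

open Filter Topology

open Classical in
/-- A finite graph on `n` vertices is a Dirac graph if its minimum degree is at least `n / 2`. -/
def SimpleGraph.IsDirac {V : Type*} [Fintype V] (G : SimpleGraph V) : Prop :=
  (Fintype.card V : ℝ) / 2 ≤ (G.minDegree : ℝ)

open Classical in
/-- `G` has an `r`-factor: an `r`-regular spanning subgraph. -/
def SimpleGraph.HasFactor {V : Type*} [Fintype V] (G : SimpleGraph V) (r : ℕ) : Prop :=
  ∃ H : SimpleGraph V, H ≤ G ∧ H.IsRegularOfDegree r

/-- `reg(G)`: the largest even `r` such that `G` has an `r`-factor. -/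
noncomputable def SimpleGraph.reg {V : Type*} [Fintype V] (G : SimpleGraph V) : ℕ :=
  sSup {r : ℕ | Even r ∧ G.HasFactor r}

/-- On a nonempty vertex set the supremum in `reg` is attained. -/
theorem SimpleGraph.isGreatest_reg {V : Type*} [Fintype V] [Nonempty V] (G : SimpleGraph V) :
    IsGreatest {r : ℕ | Even r ∧ G.HasFactor r} G.reg := by
  classical
  have hne : {r : ℕ | Even r ∧ G.HasFactor r}.Nonempty := by
    refine ⟨0, Even.zero, ⊥, bot_le, ?_⟩
    intro v
    simp
  have hbd : BddAbove {r : ℕ | Even r ∧ G.HasFactor r} := by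
    refine ⟨Fintype.card V, ?_⟩
    rintro r ⟨-, H, -, hH⟩
    obtain ⟨v⟩ := (inferInstance : Nonempty V)
    rw [← hH v]
    exact (H.degree_lt_card_verts v).le
  exact ⟨Nat.sSup_mem hne hbd, fun r hr => le_csSup hbd hr⟩

open Classical in
/-- The set of Hamilton cycles of `G`, each one recorded by its set of edges (so that the base
point and the direction in which a cycle is traversed do not matter). -/
def SimpleGraph.hamiltonCycles {V : Type*} (G : SimpleGraph V) : Set (Set (Sym2 V)) :=
  {E | ∃ (v : V) (p : G.Walk v v), p.IsHamiltonianCycle ∧ E = {e | e ∈ p.edges}}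

/-- `h(G)`: the number of distinct Hamilton cycles of the finite graph `G`. -/
noncomputable def SimpleGraph.numHamiltonCycles {V : Type*} [Fintype V] (G : SimpleGraph V) : ℕ :=
  G.hamiltonCycles.ncard

/-! The idea is to count cycle covers of a dense regular digraph inside G, and then to show that
almost all of them are close to Hamilton cycles.

A k-regular spanning digraph with k at least reg(G) and at least n/5 is available: the even factor
itself, with both orientations of each edge, if reg(G) exceeds n/4, and otherwise one of degree
⌊n/4⌋ given by Hall's theorem (`exists_regular_digraph_of_dirac`). By the van der Waerden type bound
`le_card_cycleCovers`, proved by Gurvits's capacity method, it has at least (k/e)^n cycle covers.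

Few of these covers have many short cycles. Cutting out j ordered cycles of length at most ℓ leaves
a cover of the remaining vertices, and Bregman's theorem bounds the number of such covers. Each cut
costs a factor of at most nℓ/k, whereas ordering the cycles gains j!, so the covers with at least j
short cycles form at most half of all covers once j is well above ℓ (`card_manyShortCycles_le`).
With ℓ about n^(1/5) and j = ℓ², every other cover has O(n^(4/5)) cycles.

Opening those cycles, joining them into one polygon and repairing the non-edges by Ore's rotations
changes O(n^(4/5)) edges. A cover is thus determined by a Hamilton cycle, two small sets of changed
edges and one oriented arc per cycle, so each Hamilton cycle accounts for only n^(O(n^(4/5))) =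
exp(o(n)) covers (`card_le_numHamiltonCycles_mul`). This factor is absorbed by (1 - ε)^n. -/

/-- The coefficient of `∏ c ∈ cs, y c` in `∏ i ∈ I, (u i + ∑ c ∈ cs, a i c * y c)`, expanded column
by column. -/
def mixedPermanent {ι κ R : Type*} [DecidableEq ι] [CommSemiring R] (a : ι → κ → R) :
    List κ → Finset ι → (ι → R) → R
  | [], I, u => ∏ i ∈ I, u i
  | c :: cs, I, u => ∑ i ∈ I, a i c * mixedPermanent a cs (I.erase i) u

/-! ### Mixed permanents: stability and real-rootedness. -/

section MixedPermanent

variable {ι κ : Type*} [DecidableEq ι]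

theorem map_mixedPermanent {R S : Type*} [CommSemiring R] [CommSemiring S] (f : R →+* S)
    (a : ι → κ → R) (cs : List κ) (I : Finset ι) (u : ι → R) :
    f (mixedPermanent a cs I u) =
      mixedPermanent (fun i c => f (a i c)) cs I (fun i => f (u i)) := by
  induction cs generalizing I with
  | nil => simp [mixedPermanent]
  | cons c cs ih => simp [mixedPermanent, ih]

-- Differentiating in the direction of a column appends that column to the list; this turns the
-- combinatorial recursion into calculus in one variable.
open Polynomial in
theorem derivative_mixedPermanent {R : Type*} [CommRing R] (a : ι → κ → R) (cs : List κ) (c : κ)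
    (I : Finset ι) (u : ι → R) :
    derivative (mixedPermanent (fun i d => C (a i d)) cs I (fun i => C (u i) + X * C (a i c))) =
      mixedPermanent (fun i d => C (a i d)) (cs ++ [c]) I (fun i => C (u i) + X * C (a i c)) := by
  induction cs generalizing I with
  | nil =>
    simp only [mixedPermanent, List.nil_append, derivative_prod_finset]
    refine Finset.sum_congr rfl fun i _ => ?_
    simp [-X_mul_C, mul_comm (C (a i c))]
  | cons d cs ih => simp [-X_mul_C, mixedPermanent, ih]

-- The top coefficient in the direction `v` does not see `u`. It serves to show that the polynomial
-- is not constant, and to treat the last column in the capacity argument.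
open Polynomial in
theorem coeff_mixedPermanent {R : Type*} [CommRing R] (a : ι → κ → R) (cs : List κ)
    (I : Finset ι) (u v : ι → R) (d : ℕ) (hd : I.card = d + cs.length) :
    (mixedPermanent (fun i d => C (a i d)) cs I (fun i => C (u i) + X * C (v i))).natDegree ≤ d ∧
      (mixedPermanent (fun i d => C (a i d)) cs I (fun i => C (u i) + X * C (v i))).coeff d =
        mixedPermanent a cs I v := by
  induction cs generalizing I with
  | nil =>
    have h1 : ∀ i ∈ I, (C (u i) + X * C (v i)).natDegree ≤ 1 := fun i _ => by
      compute_degree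
    simp only [List.length_nil, add_zero] at hd
    subst hd
    constructor
    · refine (natDegree_prod_le _ _).trans ((Finset.sum_le_sum h1).trans ?_)
      simp
    · have := coeff_prod_of_natDegree_le I (fun i => C (u i) + X * C (v i)) 1 h1
      simp only [mul_one] at this
      simp only [mixedPermanent]
      rw [this]
      simp [coeff_C]
  | cons e cs ih =>
    have h : ∀ i ∈ I, (I.erase i).card = d + cs.length := fun i hi => by
      rw [Finset.card_erase_of_mem hi, hd]; simp [← add_assoc]
    constructor
    · simp only [mixedPermanent]
      refine natDegree_sum_le_of_forall_le _ _ fun i hi => ?_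
      exact (natDegree_C_mul_le _ _).trans (ih _ (h i hi)).1
    · simp only [mixedPermanent, finsetSum_coeff, coeff_C_mul]
      exact Finset.sum_congr rfl fun i hi => by rw [(ih _ (h i hi)).2]

theorem mixedPermanent_pos {a : ι → κ → ℝ} (ha : ∀ i c, 0 < a i c) (cs : List κ)
    (I : Finset ι) (u : ι → ℝ) (hu : ∀ i, 0 < u i) (h : cs.length ≤ I.card) :
    0 < mixedPermanent a cs I u := by
  induction cs generalizing I with
  | nil => exact Finset.prod_pos fun i _ => hu i
  | cons c cs ih =>
    simp only [List.length_cons] at h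
    refine Finset.sum_pos (fun i hi => mul_pos (ha i c) (ih _ ?_)) ?_
    · rw [Finset.card_erase_of_mem hi]; omega
    · exact Finset.card_pos.1 (by omega)

/-- Stability: for positive columns the mixed permanent does not vanish on the product of upper
half planes. -/
theorem mixedPermanent_ne_zero_of_im_pos {a : ι → κ → ℝ} (ha : ∀ i c, 0 < a i c) (cs : List κ)
    (I : Finset ι) (u : ι → ℂ) (hu : ∀ i, 0 < (u i).im) (h : cs.length ≤ I.card) :
    mixedPermanent (fun i c => (a i c : ℂ)) cs I u ≠ 0 := by
  induction cs using List.reverseRecOn generalizing u with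
  | nil =>
    refine Finset.prod_ne_zero_iff.2 fun i _ h0 => ?_
    have := hu i
    simp [h0] at this
  | append_singleton cs c ih =>
    simp only [List.length_append, List.length_singleton] at h
    obtain ⟨d, hd⟩ : ∃ d, I.card = (d + 1) + cs.length := ⟨I.card - cs.length - 1, by omega⟩
    -- The value to be shown nonzero is g'(0), where g moves `u` along column `c`.
    set g : Polynomial ℂ := mixedPermanent (fun i d => Polynomial.C (a i d : ℂ)) cs I
      (fun i => Polynomial.C (u i) + Polynomial.X * Polynomial.C (a i c : ℂ)) with hg
    have hev : ∀ y : ℂ, g.eval y =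
        mixedPermanent (fun i c => (a i c : ℂ)) cs I (fun i => u i + y * a i c) := fun y => by
      have := map_mixedPermanent (Polynomial.evalRingHom y)
        (fun i d => Polynomial.C (a i d : ℂ)) cs I
        (fun i => Polynomial.C (u i) + Polynomial.X * Polynomial.C (a i c : ℂ))
      simpa [-Polynomial.X_mul_C, hg] using this
    have hev' : g.derivative.eval 0 =
        mixedPermanent (fun i c => (a i c : ℂ)) (cs ++ [c]) I u := by
      have h1 := derivative_mixedPermanent (fun i d => (a i d : ℂ)) cs c I u
      rw [hg, h1]
      have := map_mixedPermanent (Polynomial.evalRingHom 0)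
        (fun i d => Polynomial.C (a i d : ℂ)) (cs ++ [c]) I
        (fun i => Polynomial.C (u i) + Polynomial.X * Polynomial.C (a i c : ℂ))
      simpa using this
    have hcoeff : g.coeff (d + 1) ≠ 0 := by
      have h1 := (coeff_mixedPermanent (fun i d => (a i d : ℂ)) cs I u (fun i => (a i c : ℂ))
        (d + 1) hd).2
      rw [hg, h1]
      have h2 := map_mixedPermanent Complex.ofRealHom a cs I (fun i => a i c)
      simp only [Complex.ofRealHom_eq_coe] at h2
      rw [← h2]
      exact_mod_cast (mixedPermanent_pos ha cs I _ (fun i => ha i c) (by omega)).ne'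
    have hdeg : 0 < g.degree := by
      have := Polynomial.le_degree_of_ne_zero hcoeff
      refine lt_of_lt_of_le ?_ this
      exact_mod_cast Nat.succ_pos d
    rw [← hev']
    intro h0
    have hd0 : g.derivative ≠ 0 := by
      intro h'
      have : g.derivative.coeff d = 0 := by simp [h']
      rw [Polynomial.coeff_derivative] at this
      rcases mul_eq_zero.1 this with h' | h'
      · exact hcoeff h'
      · exact absurd h' (by exact_mod_cast Nat.succ_ne_zero d)
    have hmem : (0 : ℂ) ∈ g.derivative.rootSet ℂ := by
      rw [Polynomial.mem_rootSet]
      exact ⟨hd0, by simpa using h0⟩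
    -- Gauss–Lucas: by induction all roots of g lie in the open lower half plane, hence so do those
    -- of g', and 0 is not among them.
    have hsub := Polynomial.rootSet_derivative_subset_convexHull_rootSet hdeg hmem
    have hhalf : convexHull ℝ (g.rootSet ℂ) ⊆ {z : ℂ | z.im < 0} := by
      refine convexHull_min ?_ ?_
      · intro y hy
        rw [Polynomial.mem_rootSet] at hy
        by_contra hy'
        simp only [Set.mem_ofPred_eq, not_lt] at hy'
        have h1 : g.eval y = 0 := by simpa using hy.2
        rw [hev] at h1
        refine ih _ (fun i => ?_) (by omega) h1
        have := mul_nonneg hy' (ha i c).le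
        simp only [Complex.add_im, Complex.mul_im, Complex.ofReal_im, Complex.ofReal_re, mul_zero,
          zero_add]
        linarith [hu i]
      · exact convex_halfSpace_lt Complex.imCLM.toLinearMap.isLinear 0
    have := hhalf hsub
    simp at this

theorem norm_prod_le_exp_of_real_neg (s : Multiset ℂ) (hs : ∀ x ∈ s, x.im = 0 ∧ x.re < 0)
    (t : ℝ) (ht : 0 ≤ t) :
    ‖(s.map fun x => ((t : ℂ) - x)).prod‖ ≤
      ‖(s.map fun x => ((0 : ℂ) - x)).prod‖ *
        Real.exp (t * ((s.map fun x => 1 / ((0 : ℂ) - x)).sum).re) := by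
  induction s using Multiset.induction_on with
  | empty => simp
  | cons x s ih =>
    have hx := hs x (Multiset.mem_cons_self _ _)
    have ih := ih fun y hy => hs y (Multiset.mem_cons_of_mem hy)
    obtain ⟨r, rfl⟩ : ∃ r : ℝ, x = r := ⟨x.re, Complex.ext rfl (by simpa using hx.1)⟩
    have hr : r < 0 := by simpa using hx.2
    simp only [Multiset.map_cons, Multiset.prod_cons, Multiset.sum_cons, norm_mul]
    -- This is 1 + x ≤ exp x applied to a single root factor.
    have h1 : ‖(t : ℂ) - r‖ ≤ ‖(0 : ℂ) - r‖ * Real.exp (t * (1 / (0 - r))) := by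
      rw [← Complex.ofReal_sub, Complex.norm_real, zero_sub, norm_neg, Complex.norm_real,
        Real.norm_eq_abs, Real.norm_eq_abs, abs_of_pos (by linarith), abs_of_neg hr]
      have := Real.add_one_le_exp (t * (1 / (0 - r)))
      have h3 : t - r = -r * (t * (1 / (0 - r)) + 1) := by
        rw [zero_sub, mul_add, one_div, mul_left_comm, mul_inv_cancel₀ (by simpa using hr.ne)]
        ring
      calc t - r = -r * (t * (1 / (0 - r)) + 1) := h3
        _ ≤ _ := mul_le_mul_of_nonneg_left this (by linarith)
    have h2 : (1 / ((0 : ℂ) - r)).re = 1 / (0 - r) := by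
      have : (1 / ((0 : ℂ) - r)) = ((1 / (0 - r) : ℝ) : ℂ) := by push_cast; rfl
      rw [this, Complex.ofReal_re]
    rw [Complex.add_re, h2, mul_add, Real.exp_add]
    calc _ ≤ _ := mul_le_mul h1 ih (norm_nonneg _) (by positivity)
      _ = _ := by ring

/-- A complex polynomial whose roots are all real and negative satisfies
`|p t| ≤ |p 0| * exp (t * p' 0 / p 0)` for `t ≥ 0`. -/
theorem norm_eval_le_of_roots_real_neg (p : Polynomial ℂ)
    (hp : ∀ y, p.eval y = 0 → y.im = 0 ∧ y.re < 0) (t : ℝ) (ht : 0 ≤ t) :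
    ‖p.eval (t : ℂ)‖ ≤
      ‖p.eval 0‖ * Real.exp (t * (p.derivative.eval 0 / p.eval 0).re) := by
  have h0 : p.eval 0 ≠ 0 := fun h => by simpa using (hp 0 h).2
  have hp0 : p ≠ 0 := fun h => h0 (by simp [h])
  have hs := IsAlgClosed.splits p
  rw [hs.eval_derivative_div_eval_of_ne_zero h0]
  have hev : ∀ y, p.eval y = p.leadingCoeff * (p.roots.map fun x => (y - x)).prod := fun y => by
    exact hs.eval_eq_prod_roots y
  rw [hev, hev, norm_mul, norm_mul, mul_assoc]
  refine mul_le_mul_of_nonneg_left (norm_prod_le_exp_of_real_neg _ (fun x hx => hp x ?_) t ht)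
    (norm_nonneg _)
  exact (Polynomial.mem_roots hp0).1 hx

/-- By stability and conjugation symmetry the polynomial in `t` has only real roots, and they are
negative because its values at nonnegative reals are positive. Such a polynomial p satisfies p(t) ≤
p(0) exp(t p'(0)/p(0)). -/
theorem mixedPermanent_add_le {a : ι → κ → ℝ} (ha : ∀ i c, 0 < a i c) (cs : List κ) (c : κ)
    (I : Finset ι) (u : ι → ℝ) (hu : ∀ i, 0 < u i) (h : cs.length ≤ I.card) (t : ℝ)
    (ht : 0 ≤ t) :
    mixedPermanent a cs I (fun i => u i + t * a i c) ≤ mixedPermanent a cs I u *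
      Real.exp (t * (mixedPermanent a (cs ++ [c]) I u / mixedPermanent a cs I u)) := by
  set g : Polynomial ℂ := mixedPermanent (fun i d => Polynomial.C (a i d : ℂ)) cs I
    (fun i => Polynomial.C (u i : ℂ) + Polynomial.X * Polynomial.C (a i c : ℂ)) with hg
  have hev : ∀ y : ℂ, g.eval y =
      mixedPermanent (fun i c => (a i c : ℂ)) cs I (fun i => u i + y * a i c) := fun y => by
    have := map_mixedPermanent (Polynomial.evalRingHom y)
      (fun i d => Polynomial.C (a i d : ℂ)) cs I
      (fun i => Polynomial.C (u i : ℂ) + Polynomial.X * Polynomial.C (a i c : ℂ))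
    simpa [-Polynomial.X_mul_C, hg] using this
  have hevr : ∀ y : ℝ, g.eval (y : ℂ) =
      (mixedPermanent a cs I (fun i => u i + y * a i c) : ℝ) := fun y => by
    have h2 := map_mixedPermanent Complex.ofRealHom a cs I (fun i => u i + y * a i c)
    rw [hev]
    simpa using h2.symm
  have hev0 : g.eval 0 = (mixedPermanent a cs I u : ℝ) := by
    simpa using hevr 0
  have hev' : g.derivative.eval 0 = (mixedPermanent a (cs ++ [c]) I u : ℝ) := by
    have h1 := derivative_mixedPermanent (fun i d => (a i d : ℂ)) cs c I (fun i => (u i : ℂ))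
    rw [hg, h1]
    have := map_mixedPermanent (Polynomial.evalRingHom 0)
      (fun i d => Polynomial.C (a i d : ℂ)) (cs ++ [c]) I
      (fun i => Polynomial.C (u i : ℂ) + Polynomial.X * Polynomial.C (a i c : ℂ))
    have h2 := map_mixedPermanent Complex.ofRealHom a (cs ++ [c]) I u
    simp only [Complex.ofRealHom_eq_coe] at h2
    rw [h2]
    simpa using this
  have hroots : ∀ y, g.eval y = 0 → y.im = 0 ∧ y.re < 0 := by
    intro y hy
    have him : y.im = 0 := by
      rcases lt_trichotomy y.im 0 with h' | h' | h'
      · exfalso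
        have h1 := hev (starRingEnd ℂ y)
        have h2 : g.eval (starRingEnd ℂ y) = starRingEnd ℂ (g.eval y) := by
          rw [hev, hev, map_mixedPermanent]
          simp
        rw [h2, hy, map_zero] at h1
        refine mixedPermanent_ne_zero_of_im_pos ha cs I _ (fun i => ?_) h h1.symm
        have := mul_neg_of_neg_of_pos h' (ha i c)
        simp
        linarith
      · exact h'
      · exfalso
        rw [hev] at hy
        refine mixedPermanent_ne_zero_of_im_pos ha cs I _ (fun i => ?_) h hy
        have := mul_pos h' (ha i c)
        simpa using this
    refine ⟨him, ?_⟩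
    obtain ⟨r, rfl⟩ : ∃ r : ℝ, y = r := ⟨y.re, Complex.ext rfl (by simpa using him)⟩
    by_contra hr
    simp only [Complex.ofReal_re, not_lt] at hr
    rw [hevr] at hy
    have := mixedPermanent_pos ha cs I (fun i => u i + r * a i c)
      (fun i => add_pos_of_pos_of_nonneg (hu i) (mul_nonneg hr (ha i c).le)) h
    exact this.ne' (by exact_mod_cast hy)
  have := norm_eval_le_of_roots_real_neg g hroots t ht
  rw [hevr, hev0, hev', ← Complex.ofReal_div, Complex.ofReal_re, Complex.norm_real,
    Complex.norm_real, Real.norm_eq_abs, Real.norm_eq_abs,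
    abs_of_pos (mixedPermanent_pos ha cs I u hu h),
    abs_of_pos (mixedPermanent_pos ha cs I _
      (fun i => add_pos_of_pos_of_nonneg (hu i) (mul_nonneg ht (ha i c).le)) h)] at this
  exact this

end MixedPermanent

/-! ### The capacity method and the lower bound on cycle covers. -/

section PermanentLowerBound

variable {ι κ : Type*} [DecidableEq ι]

/-- Gurvits's inequality: let p(t) be the value when the variable of column `d` is t. The hypothesis
bounds p(t)/t from below, and p(t) ≤ p(0) exp(t p'(0)/p(0)) at t = p(0)/p'(0) converts this into a
bound on p'(0), losing only a factor e. -/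
theorem mixedPermanent_capacity_step {a : ι → κ → ℝ} (ha : ∀ i c, 0 < a i c) [Nonempty ι]
    (cs ds : List κ) (d : κ)
    (I : Finset ι) (h : I.card = cs.length + (ds.length + 1)) (γ : ℝ)
    (hcap : ∀ x : κ → ℝ, (∀ c, 0 < x c) → γ * ((d :: ds).map x).prod ≤
      mixedPermanent a cs I (fun i => ((d :: ds).map fun c => x c * a i c).sum))
    (x : κ → ℝ) (hx : ∀ c, 0 < x c) (hd : d ∉ ds) :
    γ * Real.exp (-1) * (ds.map x).prod ≤
      mixedPermanent a (cs ++ [d]) I (fun i => (ds.map fun c => x c * a i c).sum) := by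
  classical
  have hupd : ∀ t : ℝ, ∀ f : ℝ → κ → ℝ, ds.map (fun c => f (Function.update x d t c) c) =
      ds.map (fun c => f (x c) c) := fun t f => by
    refine List.map_congr_left fun c hc => ?_
    rw [Function.update_of_ne]
    rintro rfl
    exact hd hc
  have hcap' : ∀ t : ℝ, 0 < t → γ * (t * (ds.map x).prod) ≤
      mixedPermanent a cs I (fun i => (ds.map fun c => x c * a i c).sum + t * a i d) := by
    intro t ht
    have := hcap (Function.update x d t) (fun c => by
      by_cases hc : c = d
      · subst hc; simpa using ht
      · simpa [hc] using hx c)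
    simp only [List.map_cons, List.prod_cons, List.sum_cons, Function.update_self] at this
    have h1 := hupd t (fun y _ => y)
    rw [h1] at this
    refine this.trans (le_of_eq ?_)
    congr 1
    funext i
    rw [add_comm, hupd t (fun y c => y * a i c)]
  rcases ds with _ | ⟨e, ds⟩
  · simp only [List.map_nil, List.sum_nil, List.prod_nil, mul_one, zero_add] at hcap' ⊢
    -- For the last column p(0) = 0, so no such t exists; but p is then linear and p'(0) = p(1)
    -- directly.
    have h1 := coeff_mixedPermanent a cs I (fun _ => (0 : ℝ)) (fun i => a i d) 1 (by simp at h; omega)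
    have h2 := derivative_mixedPermanent a cs d I (fun _ => (0 : ℝ))
    have h3 := congrArg (fun p => Polynomial.coeff p 0) h2
    simp only [Polynomial.coeff_derivative] at h3
    rw [Nat.zero_add, h1.2] at h3
    have h4 := map_mixedPermanent (Polynomial.evalRingHom (0 : ℝ))
        (fun i d => Polynomial.C (a i d)) (cs ++ [d]) I
        (fun i => Polynomial.C 0 + Polynomial.X * Polynomial.C (a i d))
    rw [Polynomial.coe_evalRingHom, ← Polynomial.coeff_zero_eq_eval_zero, ← h3] at h4
    simp only [Polynomial.eval_add, Polynomial.eval_mul, Polynomial.eval_C, Polynomial.eval_X,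
      zero_mul, zero_add, CharP.cast_eq_zero, mul_one] at h4
    rw [← h4]
    have h5 := hcap' 1 one_pos
    simp only [one_mul, mul_one] at h5
    have hpos := mixedPermanent_pos ha cs I (fun i => a i d) (fun i => ha i d) (by omega)
    have h6 : Real.exp (-1) ≤ 1 := Real.exp_le_one_iff.2 (by norm_num)
    have h7 := Real.exp_pos (-1)
    rcases le_or_gt γ 0 with hγ | hγ
    · exact (mul_nonpos_of_nonpos_of_nonneg hγ h7.le).trans hpos.le
    · exact (mul_le_of_le_one_right hγ.le h6).trans h5
  · set u : ι → ℝ := fun i => ((e :: ds).map fun c => x c * a i c).sum with hu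
    have hupos : ∀ i, 0 < u i := fun i => by
      simp only [hu]
      refine List.sum_pos _ ?_ (by simp)
      simp only [List.mem_map]
      rintro _ ⟨c, -, rfl⟩
      exact mul_pos (hx c) (ha i c)
    have hf0 := mixedPermanent_pos ha cs I u hupos (by omega)
    have hf1 := mixedPermanent_pos ha (cs ++ [d]) I u hupos (by simp; omega)
    set f0 := mixedPermanent a cs I u
    set f1 := mixedPermanent a (cs ++ [d]) I u
    have h1 := mixedPermanent_add_le ha cs d I u hupos (by omega) (f0 / f1) (by positivity)
    have h2 := (hcap' (f0 / f1) (by positivity)).trans h1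
    have h3 : f0 / f1 * (f1 / f0) = 1 := by field_simp
    rw [h3] at h2
    have h4 : γ * ((e :: ds).map x).prod ≤ f1 * Real.exp 1 := by
      have : γ * (f0 / f1 * ((e :: ds).map x).prod) * (f1 / f0) ≤
          f0 * Real.exp 1 * (f1 / f0) := mul_le_mul_of_nonneg_right h2 (by positivity)
      have e1 : γ * (f0 / f1 * ((e :: ds).map x).prod) * (f1 / f0) = γ * ((e :: ds).map x).prod := by
        rw [show γ * (f0 / f1 * ((e :: ds).map x).prod) * (f1 / f0) =
          γ * ((e :: ds).map x).prod * (f0 / f1 * (f1 / f0)) by ring, h3, mul_one]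
      have e2 : f0 * Real.exp 1 * (f1 / f0) = f1 * Real.exp 1 := by field_simp
      rwa [e1, e2] at this
    calc γ * Real.exp (-1) * ((e :: ds).map x).prod
        = γ * ((e :: ds).map x).prod * Real.exp (-1) := by ring
      _ ≤ f1 * Real.exp 1 * Real.exp (-1) := mul_le_mul_of_nonneg_right h4 (Real.exp_pos _).le
      _ = f1 := by rw [mul_assoc, ← Real.exp_add]; simp

/-- Each step trades one free variable for one differentiated column at the price of a factor 1/e.
-/
theorem mixedPermanent_capacity {a : ι → κ → ℝ} (ha : ∀ i c, 0 < a i c) [Nonempty ι]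
    (cs ds : List κ) (hds : ds.Nodup)
    (I : Finset ι) (h : I.card = cs.length + ds.length) (γ : ℝ)
    (hcap : ∀ x : κ → ℝ, (∀ c, 0 < x c) → γ * (ds.map x).prod ≤
      mixedPermanent a cs I (fun i => (ds.map fun c => x c * a i c).sum)) :
    γ * Real.exp (-1) ^ ds.length ≤ mixedPermanent a (cs ++ ds) I (fun _ => 0) := by
  induction ds generalizing cs γ with
  | nil => simpa using hcap (fun _ => 1) (fun _ => one_pos)
  | cons d ds ih =>
    have := ih (cs ++ [d]) (List.nodup_cons.1 hds).2 (by simp at h ⊢; omega) (γ * Real.exp (-1))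
      fun x hx => mixedPermanent_capacity_step ha cs ds d I (by simpa using h) γ hcap x hx
        (List.nodup_cons.1 hds).1
    rw [List.append_assoc, List.singleton_append] at this
    refine le_trans (le_of_eq ?_) this
    rw [List.length_cons, pow_succ]
    ring

/-- The permanent of a positive matrix with all row and column sums `s` is at least `(s / e) ^ n`. -/
theorem mixedPermanent_lower_of_pos [Fintype ι] [Nonempty ι] {a : ι → ι → ℝ} (ha : ∀ i c, 0 < a i c)
    (s : ℝ) (hrow : ∀ i, ∑ c, a i c = s) (hcol : ∀ c, ∑ i, a i c = s) :
    (s * Real.exp (-1)) ^ Fintype.card ι ≤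
      mixedPermanent a Finset.univ.toList Finset.univ (fun _ => 0) := by
  have hs : 0 < s := by
    obtain ⟨i⟩ := (inferInstance : Nonempty ι)
    rw [← hrow i]
    exact Finset.sum_pos (fun c _ => ha i c) Finset.univ_nonempty
  have := mixedPermanent_capacity ha [] Finset.univ.toList (Finset.nodup_toList _) Finset.univ
    (by simp) (s ^ Fintype.card ι) ?_
  · simpa [mul_pow] using this
  · intro x hx
    simp only [mixedPermanent, Finset.prod_map_toList, Finset.sum_map_toList]
    -- The capacity is at least s^n: weighted AM–GM in each row, after which the column sums make
    -- the exponents of each `x c` add up to 1.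
    have hi : ∀ i, s * ∏ c, x c ^ (a i c / s) ≤ ∑ c, x c * a i c := fun i => by
      have := Real.geom_mean_le_arith_mean_weighted Finset.univ (fun c => a i c / s) x
        (fun c _ => div_nonneg (ha i c).le hs.le)
        (by rw [← Finset.sum_div, hrow, div_self hs.ne']) (fun c _ => (hx c).le)
      calc s * ∏ c, x c ^ (a i c / s) ≤ s * ∑ c, a i c / s * x c :=
            mul_le_mul_of_nonneg_left this hs.le
        _ = _ := by
          rw [Finset.mul_sum]
          refine Finset.sum_congr rfl fun c _ => ?_
          field_simp
    calc s ^ Fintype.card ι * ∏ c, x c = ∏ i : ι, (s * ∏ c, x c ^ (a i c / s)) := by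
          rw [Finset.prod_mul_distrib, Finset.prod_const, Finset.card_univ, Finset.prod_comm]
          congr 1
          refine Finset.prod_congr rfl fun c _ => ?_
          rw [← Real.rpow_sum_of_pos (hx c), ← Finset.sum_div, hcol, div_self hs.ne', Real.rpow_one]
      _ ≤ _ := Finset.prod_le_prod (fun i _ => mul_nonneg hs.le
          (Finset.prod_nonneg fun c _ => Real.rpow_nonneg (hx c).le _)) fun i _ => hi i

theorem continuous_mixedPermanent (a : ℝ → ι → κ → ℝ) (ha : ∀ i c, Continuous fun r => a r i c)
    (cs : List κ) (I : Finset ι) (u : ι → ℝ) :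
    Continuous fun r => mixedPermanent (a r) cs I u := by
  induction cs generalizing I with
  | nil => exact continuous_const
  | cons c cs ih =>
    exact continuous_finsetSum _ fun i _ => (ha i c).mul (ih _)

/-- Zero entries are reached by adding r > 0 to every entry, which keeps all row and column sums
equal, and letting r tend to 0. -/
theorem mixedPermanent_lower [Fintype ι] [Nonempty ι] {a : ι → ι → ℝ} (ha : ∀ i c, 0 ≤ a i c)
    (s : ℝ) (hrow : ∀ i, ∑ c, a i c = s) (hcol : ∀ c, ∑ i, a i c = s) :
    (s * Real.exp (-1)) ^ Fintype.card ι ≤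
      mixedPermanent a Finset.univ.toList Finset.univ (fun _ => 0) := by
  have h1 := (continuous_mixedPermanent (fun r i c => a i c + r) (fun i c => by fun_prop)
    Finset.univ.toList (Finset.univ : Finset ι) (fun _ => 0)).tendsto 0
  have h2 : Tendsto (fun r : ℝ => ((s + Fintype.card ι * r) * Real.exp (-1)) ^ Fintype.card ι)
      (𝓝 0) (𝓝 (((s + Fintype.card ι * 0) * Real.exp (-1)) ^ Fintype.card ι)) :=
    Continuous.tendsto (by fun_prop) 0
  simp only [add_zero, mul_zero] at h1 h2
  refine le_of_tendsto_of_tendsto (h2.mono_left nhdsWithin_le_nhds)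
    (h1.mono_left (nhdsWithin_le_nhds (s := Set.Ioi 0))) ?_
  filter_upwards [self_mem_nhdsWithin] with r hr
  refine mixedPermanent_lower_of_pos (fun i c => add_pos_of_nonneg_of_pos (ha i c) hr) _ ?_ ?_
  · intro i; simp [Finset.sum_add_distrib, hrow]
  · intro i; simp [Finset.sum_add_distrib, hcol]

/-- The functions assigning to the columns `cs` distinct rows in `I`, compatibly with `r`, and equal
to `id` elsewhere. -/
def columnChoices [Fintype ι] (r : ι → ι → Prop) [DecidableRel r] :
    List ι → Finset ι → Finset (ι → ι)
  | [], _ => {id}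
  | c :: cs, I => (I.filter fun i => r i c).biUnion fun i =>
      (columnChoices r cs (I.erase i)).image fun f => Function.update f c i

theorem columnChoices_spec [Fintype ι] (r : ι → ι → Prop) [DecidableRel r] (cs : List ι) (I : Finset ι)
    (f : ι → ι) (hf : f ∈ columnChoices r cs I) :
    (∀ c ∈ cs, f c ∈ I ∧ r (f c) c) ∧ (∀ c ∉ cs, f c = c) ∧ Set.InjOn f {c | c ∈ cs} := by
  induction cs generalizing I f with
  | nil =>
    simp only [columnChoices, Finset.mem_singleton] at hf
    subst hf
    simp
  | cons c cs ih =>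
    simp only [columnChoices, Finset.mem_biUnion, Finset.mem_filter, Finset.mem_image] at hf
    obtain ⟨i, ⟨hi, hr⟩, g, hg, rfl⟩ := hf
    obtain ⟨h1, h2, h3⟩ := ih _ _ hg
    refine ⟨?_, ?_, ?_⟩
    · intro d hd
      by_cases hdc : d = c
      · subst hdc; simp [hi, hr]
      · have hd' : d ∈ cs := by simpa [hdc] using hd
        have := h1 d hd'
        simp only [Function.update_of_ne hdc]
        exact ⟨Finset.mem_of_mem_erase this.1, this.2⟩
    · intro d hd
      simp only [List.mem_cons, not_or] at hd
      rw [Function.update_of_ne hd.1]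
      exact h2 d hd.2
    · intro d hd e he hde
      simp only [Set.mem_ofPred_eq, List.mem_cons] at hd he
      by_cases hdc : d = c <;> by_cases hec : e = c
      · rw [hdc, hec]
      · subst hdc
        rw [Function.update_self, Function.update_of_ne hec] at hde
        have := (h1 e (he.resolve_left hec)).1
        rw [← hde] at this
        simp at this
      · subst hec
        rw [Function.update_self, Function.update_of_ne hdc] at hde
        have := (h1 d (hd.resolve_left hdc)).1
        rw [hde] at this
        simp at this
      · rw [Function.update_of_ne hdc, Function.update_of_ne hec] at hde
        exact h3 (hd.resolve_left hdc) (he.resolve_left hec) hde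

/-- When there are as many columns as rows, the expansion uses up all rows, so `u` plays no role and
every surviving term is one choice function. -/
theorem card_columnChoices [Fintype ι] (r : ι → ι → Prop) [DecidableRel r] (cs : List ι) (hcs : cs.Nodup)
    (I : Finset ι) (h : I.card = cs.length) (u : ι → ℝ) :
    mixedPermanent (fun i c => if r i c then (1 : ℝ) else 0) cs I u =
      (columnChoices r cs I).card := by
  induction cs generalizing I with
  | nil =>
    have : I = ∅ := by simpa using h
    simp [mixedPermanent, columnChoices, this]
  | cons c cs ih =>
    obtain ⟨hc, hcs⟩ := List.nodup_cons.1 hcs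
    simp only [mixedPermanent, columnChoices]
    rw [Finset.card_biUnion]
    · push_cast
      rw [Finset.sum_filter]
      refine Finset.sum_congr rfl fun i hi => ?_
      split_ifs with hr
      · rw [Finset.card_image_of_injOn, one_mul,
          ih hcs _ (by rw [Finset.card_erase_of_mem hi, h]; simp)]
        intro f hf g hg hfg
        have hf' := (columnChoices_spec r cs _ f hf).2.1 c hc
        have hg' := (columnChoices_spec r cs _ g hg).2.1 c hc
        funext d
        by_cases hd : d = c
        · rw [hd, hf', hg']
        · simpa [hd] using congrFun hfg d
      · simp
    · intro i _ j _ hij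
      rw [Function.onFun, Finset.disjoint_left]
      simp only [Finset.mem_image, not_exists, not_and]
      rintro _ ⟨f, -, rfl⟩ g - hfg
      have := congrFun hfg c
      simp only [Function.update_self] at this
      exact hij this.symm

/-- A directed graph on `n` vertices in which all in- and outdegrees are `k` has at least
`(k / e) ^ n` cycle covers. -/
theorem le_card_cycleCovers {V : Type*} [Fintype V] [DecidableEq V] [Nonempty V]
    (t : V → Finset V) (k : ℕ) (hout : ∀ v, (t v).card = k)
    (hin : ∀ w, (Finset.univ.filter fun v => w ∈ t v).card = k) :
    ((k : ℝ) * Real.exp (-1)) ^ Fintype.card V ≤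
      ((Finset.univ.filter fun σ : Equiv.Perm V => ∀ v, σ v ∈ t v).card : ℝ) := by
  have h := mixedPermanent_lower (a := fun i c : V => if i ∈ t c then (1 : ℝ) else 0)
    (fun i c => by positivity) k (fun i => by simp [hin]) (fun c => by simp [hout])
  rw [card_columnChoices (fun i c => i ∈ t c) _ (Finset.nodup_toList _) _ (by simp)] at h
  refine h.trans ?_
  norm_cast
  have hmem : ∀ f ∈ columnChoices (fun i c : V => i ∈ t c) Finset.univ.toList Finset.univ,
      (∀ c, f c ∈ t c) ∧ Function.Bijective f := fun f hf => by
    obtain ⟨h1, -, h3⟩ := columnChoices_spec _ _ _ f hf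
    refine ⟨fun c => (h1 c (by simp)).2, Finite.injective_iff_bijective.1 fun x y hxy => ?_⟩
    exact h3 (by simp) (by simp) hxy
  refine Finset.card_le_card_of_surjOn (fun σ : Equiv.Perm V => (σ : V → V)) ?_
  intro f hf
  obtain ⟨h1, h2⟩ := hmem f hf
  exact ⟨Equiv.ofBijective f h2, by simpa using h1, rfl⟩

end PermanentLowerBound

/-! ### Bregman's upper bound for permanents. -/

section Bregman

/-- The logarithm of the geometric mean of `1, …, r`. -/
noncomputable def logFactorialMean (r : ℕ) : ℝ := Real.log (r.factorial : ℝ) / r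

theorem mul_logFactorialMean (r : ℕ) : r * logFactorialMean r = Real.log (r.factorial : ℝ) := by
  rcases Nat.eq_zero_or_pos r with rfl | hr
  · simp
  · rw [logFactorialMean, mul_div_cancel₀]
    exact_mod_cast hr.ne'

/-- The bijections `σ` with `σ i ∈ t i` for all `i`. -/
def equivsIn {α β : Type*} [Fintype α] [Fintype β] [DecidableEq α] [DecidableEq β]
    (t : α → Finset β) : Finset (α ≃ β) :=
  Finset.univ.filter fun σ => ∀ i, σ i ∈ t i

/-- Jensen's inequality for the convex function x log x, with 0 log 0 = 0. -/
theorem mul_log_sum_le {β : Type*} (s : Finset β) (p : β → ℝ) (hp : ∀ k ∈ s, 0 ≤ p k)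
    (hs : s.Nonempty) :
    (∑ k ∈ s, p k) * Real.log (∑ k ∈ s, p k) ≤
      (∑ k ∈ s, p k) * Real.log s.card + ∑ k ∈ s, p k * Real.log (p k) := by
  have hr : (0 : ℝ) < s.card := by exact_mod_cast hs.card_pos
  have h := Real.convexOn_mul_log.map_sum_le (t := s) (w := fun _ => (s.card : ℝ)⁻¹) (p := p)
    (fun _ _ => by positivity) (by simp [hr.ne']) (fun k hk => hp k hk)
  simp only [smul_eq_mul] at h
  rw [← Finset.mul_sum, ← Finset.mul_sum] at h
  set P := ∑ k ∈ s, p k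
  have h2 := mul_le_mul_of_nonneg_left h hr.le
  rw [← mul_assoc, ← mul_assoc, mul_inv_cancel₀ hr.ne', one_mul, ← mul_assoc, mul_inv_cancel₀ hr.ne',
    one_mul] at h2
  rcases (Finset.sum_nonneg hp).eq_or_lt with h0 | h0
  · have h0 : P = 0 := h0.symm
    rw [h0] at h2 ⊢
    simpa using h2
  · rw [Real.log_mul (by positivity) h0.ne', Real.log_inv] at h2
    linarith

/-- With r = |s|, deleting k ≠ b shrinks s for r - 1 values of k, contributing log (r - 1)! in all,
and leaves s intact for the others. Together with log r this makes log r!, that is, r times the mean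
at r. -/
theorem sum_logFactorialMean_erase {β : Type*} [Fintype β] [DecidableEq β] (s : Finset β) (b : β)
    (hb : b ∈ s) :
    Real.log s.card + ∑ k ∈ Finset.univ.erase b, logFactorialMean (s.erase k).card =
      Fintype.card β * logFactorialMean s.card := by
  have hpos : 0 < s.card := Finset.card_pos.2 ⟨b, hb⟩
  have h1 : ∑ k ∈ Finset.univ.erase b, logFactorialMean (s.erase k).card =
      (s.card - 1 : ℕ) * logFactorialMean (s.card - 1) +
        (Fintype.card β - s.card : ℕ) * logFactorialMean s.card := by
    have h2 : (Finset.univ.erase b : Finset β) = s.erase b ∪ sᶜ := by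
      ext x
      by_cases hx : x = b
      · subst hx; simp [hb]
      · by_cases hx' : x ∈ s <;> simp [hx, hx']
    rw [h2, Finset.sum_union]
    · congr 1
      · rw [Finset.sum_congr rfl (g := fun _ => logFactorialMean (s.card - 1))]
        · simp [Finset.card_erase_of_mem hb]
        · intro x hx
          rw [Finset.card_erase_of_mem (Finset.mem_of_mem_erase hx)]
      · rw [Finset.sum_congr rfl (g := fun _ => logFactorialMean s.card)]
        · simp [Finset.card_compl]
        · intro x hx
          rw [Finset.erase_eq_of_notMem (by simpa using hx)]
    · rw [Finset.disjoint_left]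
      intro x hx
      simpa using Finset.mem_of_mem_erase hx
  rw [h1, mul_logFactorialMean, ← add_assoc, ← Real.log_mul, Nat.cast_sub (Finset.card_le_univ s)]
  · have : (s.card : ℝ) * ((s.card - 1).factorial : ℝ) = s.card.factorial := by
      exact_mod_cast Nat.mul_factorial_pred hpos.ne'
    rw [this, ← mul_logFactorialMean]
    ring
  · exact_mod_cast hpos.ne'
  · exact_mod_cast (Nat.factorial_pos _).ne'

/-- Bregman's theorem on permanents of zero-one matrices (Schrijver's proof). -/
theorem log_card_equivsIn_le {α β : Type*} [Fintype α] [Fintype β] [DecidableEq α] [DecidableEq β]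
    (t : α → Finset β) (h : (equivsIn t).Nonempty) :
    Real.log (equivsIn t).card ≤ ∑ i, logFactorialMean (t i).card := by
  obtain ⟨n, hn⟩ : ∃ n, Fintype.card α = n := ⟨_, rfl⟩
  induction n generalizing α β with
  | zero =>
    have := Fintype.card_eq_zero_iff.1 hn
    have : (equivsIn t).card ≤ 1 := by
      refine Finset.card_le_one.2 fun a _ b _ => Equiv.ext fun x => isEmptyElim x
    have h1 : (equivsIn t).card = 1 := le_antisymm this h.card_pos
    simp [h1]
  | succ n ih =>
    obtain ⟨σ₀, hσ₀⟩ := h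
    have hmem : ∀ σ, σ ∈ equivsIn t ↔ ∀ i, σ i ∈ t i := fun σ => by simp [equivsIn]
    set P : ℝ := ((equivsIn t).card : ℝ) with hP
    have hPpos : 0 < P := by
      rw [hP]; exact_mod_cast Finset.card_pos.2 ⟨σ₀, hσ₀⟩
    set p : α → β → ℝ := fun i k => (((equivsIn t).filter fun σ => σ i = k).card : ℝ) with hp
    have hsum : ∀ i, ∑ k ∈ t i, p i k = P := fun i => by
      have := Finset.card_eq_sum_card_fiberwise (s := equivsIn t) (t := t i) (f := fun σ => σ i)
        (fun σ hσ => (hmem σ).1 hσ i)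
      rw [hP, this]
      push_cast
      rfl
    have hbound : ∀ i k, p i k * Real.log (p i k) ≤
        p i k * ∑ j ∈ Finset.univ.erase i, logFactorialMean ((t j).erase k).card := by
      intro i k
      refine mul_le_mul_of_nonneg_left ?_ (by positivity)
      rcases Finset.eq_empty_or_nonempty ((equivsIn t).filter fun σ => σ i = k) with h0 | h0
      · have : p i k = 0 := by simp [hp, h0]
        -- The induction hypothesis needs a nonempty family; here `Real.log 0 = 0` settles the case
        -- instead.
        rw [this, Real.log_zero]
        refine Finset.sum_nonneg fun j _ => div_nonneg (Real.log_nonneg ?_) (by positivity)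
        exact_mod_cast Nat.succ_le_of_lt (Nat.factorial_pos _)
      · set t' : {x // x ≠ i} → Finset {y // y ≠ k} := fun x => (t x).subtype (· ≠ k) with ht'
        have hcard : ∀ x, (t' x).card = ((t x).erase k).card := fun x => by
          rw [ht', Finset.card_subtype, Finset.filter_ne']
        have hinj : ((equivsIn t).filter fun σ => σ i = k).card ≤ (equivsIn t').card := by
          rw [← Finset.card_attach]
          have hσk : ∀ σ ∈ (equivsIn t).filter fun σ => σ i = k, σ i = k := fun σ hσ =>
            (Finset.mem_filter.1 hσ).2
          refine Finset.card_le_card_of_injOn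
            (fun σ => σ.1.subtypeEquiv (p := (· ≠ i)) (q := (· ≠ k)) (fun x => by
              simp only [ne_eq, not_iff_not]
              exact ⟨fun h => h ▸ hσk σ.1 σ.2,
                fun h => σ.1.injective (h.trans (hσk σ.1 σ.2).symm)⟩)) ?_ ?_
          · intro σ _
            have := (hmem σ.1).1 (Finset.mem_filter.1 σ.2).1
            simp [equivsIn, ht', this]
          · intro σ _ τ _ hστ
            refine Subtype.ext (Equiv.ext fun x => ?_)
            by_cases hx : x = i
            · rw [hx, hσk _ σ.2, hσk _ τ.2]
            · simpa using congrArg Subtype.val (Equiv.congr_fun hστ ⟨x, hx⟩)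
        have hne : (equivsIn t').Nonempty := Finset.card_pos.1 (h0.card_pos.trans_le hinj)
        have h2 := ih t' hne (by simp [hn])
        have h3 : Real.log (p i k) ≤ Real.log (equivsIn t').card :=
          Real.log_le_log (Nat.cast_pos.2 h0.card_pos) (Nat.cast_le.2 hinj)
        refine (h3.trans h2).trans (le_of_eq ?_)
        simp_rw [hcard]
        rw [← Finset.sum_subtype (Finset.univ.erase i) (by simp)
          (fun j => logFactorialMean ((t j).erase k).card)]
    have hrow : ∀ i, P * Real.log P ≤ P * Real.log (t i).card +
        ∑ σ ∈ equivsIn t, ∑ j ∈ Finset.univ.erase i,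
          logFactorialMean ((t j).erase (σ i)).card := fun i => by
      have h1 := mul_log_sum_le (t i) (p i) (fun k _ => by positivity) ⟨σ₀ i, (hmem _).1 hσ₀ i⟩
      rw [hsum] at h1
      refine h1.trans (add_le_add_right ((Finset.sum_le_sum fun k _ => hbound i k).trans
        (le_of_eq ?_)) _)
      rw [← Finset.sum_fiberwise_of_maps_to (s := equivsIn t) (t := t i) (g := fun σ => σ i)
        (fun σ hσ => (hmem σ).1 hσ i)]
      refine Finset.sum_congr rfl fun k _ => ?_
      rw [hp, ← nsmul_eq_mul, ← Finset.sum_const]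
      refine Finset.sum_congr rfl fun σ hσ => ?_
      rw [(Finset.mem_filter.1 hσ).2]
    have htotal := Finset.sum_le_sum fun i (_ : i ∈ Finset.univ) => hrow i
    -- For a fixed σ, exchanging the sums groups the deletions by the row j that they affect;
    -- reindexing i by σ i gives the sum over deleted columns.
    have hcol : ∀ σ ∈ equivsIn t, ∑ i, Real.log (t i).card + ∑ i, ∑ j ∈ Finset.univ.erase i,
        logFactorialMean ((t j).erase (σ i)).card =
          (n + 1 : ℕ) * ∑ j, logFactorialMean (t j).card := by
      intro σ hσ
      have hswap : ∑ i, ∑ j ∈ Finset.univ.erase i, logFactorialMean ((t j).erase (σ i)).card =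
          ∑ j, ∑ i ∈ Finset.univ.erase j, logFactorialMean ((t j).erase (σ i)).card := by
        refine Finset.sum_comm' fun i j => ?_
        simp [eq_comm]
      rw [hswap, ← Finset.sum_add_distrib, Finset.mul_sum]
      refine Finset.sum_congr rfl fun j _ => ?_
      have h1 := sum_logFactorialMean_erase (t j) (σ j) ((hmem σ).1 hσ j)
      rw [← Fintype.card_congr σ, hn] at h1
      rw [← h1]
      congr 1
      refine Finset.sum_bij (fun i _ => σ i) (by simp) (by simp) ?_ (by simp)
      intro b hb
      exact ⟨σ.symm b, by simpa [Equiv.symm_apply_eq] using hb, by simp⟩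
    rw [Finset.sum_const, Finset.card_univ, hn, Finset.sum_add_distrib, ← Finset.mul_sum,
      Finset.sum_comm] at htotal
    have h5 : P * ∑ i, Real.log (t i).card + ∑ σ ∈ equivsIn t, ∑ i, ∑ j ∈ Finset.univ.erase i,
        logFactorialMean ((t j).erase (σ i)).card =
          P * ((n + 1 : ℕ) * ∑ j, logFactorialMean (t j).card) := by
      have h7 := Finset.sum_congr rfl hcol
      rw [Finset.sum_add_distrib, Finset.sum_const, Finset.sum_const, nsmul_eq_mul,
        nsmul_eq_mul] at h7
      exact h7
    rw [h5, nsmul_eq_mul] at htotal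
    have h6 : (0 : ℝ) < (n + 1 : ℕ) * P := by positivity
    refine le_of_mul_le_mul_left ?_ h6
    calc _ = _ := by ring
      _ ≤ _ := htotal
      _ = _ := by ring

end Bregman

/-! ### Regular spanning digraphs in Dirac graphs. -/

section DiracFactor

/-- Let b ≤ a and a + b > n. If 2b ≤ n and k ≤ b, then 2a - n ≥ 2(a + b - n) suffices; if k > b, the
claim is linear in a and tightest at a = n. If 2b > n, then b ≥ 2k, and e ≥ k(2a - n) ≥ k(a + b -
n). -/
theorem dirac_cut_arith (n k a b e : ℕ) (hk : 4 * k ≤ n) (ha : a ≤ n) (hb : b ≤ n)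
    (h1 : a * (2 * b) ≤ 2 * e + a * n) (h2 : b * (2 * a) ≤ 2 * e + b * n) :
    k * (a + b) ≤ k * n + e := by
  wlog hab : b ≤ a generalizing a b
  · rw [add_comm a b]
    exact this b a hb ha h2 h1 (by omega)
  rcases le_or_gt (a + b) n with h | h
  · exact (Nat.mul_le_mul_left k h).trans (Nat.le_add_right _ _)
  zify at *
  have hk0 : (0 : ℤ) ≤ k := by positivity
  have h2' : (b : ℤ) * (2 * a - n) ≤ 2 * e := by linarith
  rcases le_or_gt (2 * (b : ℤ)) n with hb2 | hb2
  · rcases le_or_gt (k : ℤ) b with hkb | hkb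
    · nlinarith
    · nlinarith
  · nlinarith

variable {V : Type*} [Fintype V] [DecidableEq V] (G : SimpleGraph V) [DecidableRel G.Adj]

/-- This is the cut condition behind Hall's condition below. A vertex has at least |U| - n/2
neighbours in U, and the same count from the side of U gives the second inequality required. -/
theorem dirac_cut (hG : ∀ v, Fintype.card V ≤ 2 * G.degree v) (k : ℕ)
    (hk : 4 * k ≤ Fintype.card V) (S U : Finset V) :
    k * (S.card + U.card) ≤ k * Fintype.card V + ∑ u ∈ S, (G.neighborFinset u ∩ U).card := by
  have key : ∀ S U : Finset V, S.card * (2 * U.card) ≤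
      2 * ∑ u ∈ S, (G.neighborFinset u ∩ U).card + S.card * Fintype.card V := by
    intro S U
    rw [← smul_eq_mul, ← smul_eq_mul (b := Fintype.card V), ← Finset.sum_const, ← Finset.sum_const,
      Finset.mul_sum, ← Finset.sum_add_distrib]
    refine Finset.sum_le_sum fun u _ => ?_
    have h1 := Finset.card_union_add_card_inter (G.neighborFinset u) U
    have h2 := Finset.card_le_univ (G.neighborFinset u ∪ U)
    have h3 := hG u
    rw [← G.card_neighborFinset_eq_degree] at h3
    omega
  have hswap : ∑ u ∈ U, (G.neighborFinset u ∩ S).card = ∑ u ∈ S, (G.neighborFinset u ∩ U).card := by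
    have := Finset.sum_card_bipartiteAbove_eq_sum_card_bipartiteBelow (s := S) (t := U) G.Adj
    simp only [Finset.bipartiteAbove, Finset.bipartiteBelow] at this
    have e1 : ∀ u, G.neighborFinset u ∩ S = S.filter fun a => G.Adj a u := fun u => by
      ext v
      simp [G.adj_comm u v, and_comm]
    have e2 : ∀ u, G.neighborFinset u ∩ U = U.filter fun b => G.Adj u b := fun u => by
      ext v
      simp [and_comm]
    simp_rw [e1, e2]
    exact this.symm
  refine dirac_cut_arith _ _ _ _ _ hk (Finset.card_le_univ _) (Finset.card_le_univ _) (key S U) ?_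
  rw [← hswap]
  exact key U S

/-- A graph on `n` vertices of minimum degree at least `n / 2` contains a `k`-regular spanning
directed graph whenever `4 * k ≤ n`. -/
theorem exists_regular_digraph_of_dirac (hG : ∀ v, Fintype.card V ≤ 2 * G.degree v) (k : ℕ)
    (hk : 4 * k ≤ Fintype.card V) :
    ∃ t : V → Finset V, (∀ v, t v ⊆ G.neighborFinset v) ∧ (∀ v, (t v).card = k) ∧
      ∀ w, (Finset.univ.filter fun v => w ∈ t v).card = k := by
  have hkd : ∀ v, k ≤ G.degree v := fun v => by have := hG v; omega
  -- Distinct arcs are sought: k arcs out of each vertex, to be kept, and deg w - k arcs into each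
  -- w, to be discarded.
  let fam : (V × Fin k) ⊕ (Σ w, Fin (G.degree w - k)) → Finset (V × V) := fun x =>
    Sum.elim (fun p => (G.neighborFinset p.1).image fun w => (p.1, w))
      (fun q => (G.neighborFinset q.1).image fun u => (u, q.1)) x
  have hall : ∀ J : Finset ((V × Fin k) ⊕ (Σ w, Fin (G.degree w - k))),
      J.card ≤ (J.biUnion fam).card := by
    intro J
    set S := J.toLeft.image Prod.fst with hS
    set T := J.toRight.image Sigma.fst with hT
    have h1 : J.toLeft.card ≤ k * S.card := by
      rw [mul_comm]
      have : J.toLeft ⊆ S ×ˢ Finset.univ := fun p hp => by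
        simp only [Finset.mem_product, Finset.mem_univ, and_true, hS]
        exact Finset.mem_image_of_mem _ hp
      simpa using Finset.card_le_card this
    have h2 : J.toRight.card ≤ ∑ w ∈ T, (G.degree w - k) := by
      have : J.toRight ⊆ T.sigma fun _ => Finset.univ := fun p hp => by
        simp only [Finset.mem_sigma, Finset.mem_univ, and_true, hT]
        exact Finset.mem_image_of_mem _ hp
      simpa using Finset.card_le_card this
    -- The union contains all arcs into T and all arcs from S to the complement of T.
    have h3 : (∑ w ∈ T, G.degree w) + ∑ u ∈ S, (G.neighborFinset u ∩ Tᶜ).card ≤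
        (J.biUnion fam).card := by
      have e1 : ∑ w ∈ T, G.degree w =
          (T.sigma fun w => G.neighborFinset w).card := by simp
      have e2 : ∑ u ∈ S, (G.neighborFinset u ∩ Tᶜ).card =
          (S.sigma fun u => G.neighborFinset u ∩ Tᶜ).card := by simp
      rw [e1, e2, ← Finset.card_disjSum]
      refine Finset.card_le_card_of_injOn
        (Sum.elim (fun x => (x.2, x.1)) (fun x => (x.1, x.2))) ?_ ?_
      · rintro (⟨w, u⟩ | ⟨u, w⟩) hx
        · simp only [Finset.mem_coe, Finset.inl_mem_disjSum, Finset.mem_sigma] at hx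
          obtain ⟨⟨w', j⟩, hq, rfl⟩ := Finset.mem_image.1 hx.1
          simp only [Sum.elim_inl, Finset.mem_coe, Finset.mem_biUnion]
          exact ⟨_, Finset.mem_toRight.1 hq, by simpa [fam] using hx.2⟩
        · simp only [Finset.mem_coe, Finset.inr_mem_disjSum, Finset.mem_sigma,
            Finset.mem_inter] at hx
          obtain ⟨⟨u', j⟩, hq, rfl⟩ := Finset.mem_image.1 hx.1
          simp only [Sum.elim_inr, Finset.mem_coe, Finset.mem_biUnion]
          exact ⟨_, Finset.mem_toLeft.1 hq, by simpa [fam] using hx.2.1⟩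
      · rintro (⟨w, u⟩ | ⟨u, w⟩) hx (⟨w', u'⟩ | ⟨u', w'⟩) hy hxy <;>
          simp only [Finset.mem_coe, Finset.inl_mem_disjSum, Finset.inr_mem_disjSum,
            Finset.mem_sigma, Finset.mem_inter, Finset.mem_compl, Sum.elim_inl, Sum.elim_inr,
            Prod.mk.injEq] at hx hy hxy <;>
          grind
    have h4 := dirac_cut G hG k hk S Tᶜ
    have h5 : ∑ w ∈ T, (G.degree w - k) + k * T.card = ∑ w ∈ T, G.degree w := by
      rw [mul_comm, ← smul_eq_mul, ← Finset.sum_const, ← Finset.sum_add_distrib]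
      exact Finset.sum_congr rfl fun w _ => Nat.sub_add_cancel (hkd w)
    have h6 : T.card + Tᶜ.card = Fintype.card V := Finset.card_add_card_compl T
    have h7 := Finset.card_toLeft_add_card_toRight (u := J)
    rw [← h6] at h4
    rw [mul_add, mul_add] at h4
    omega
  obtain ⟨f, hf, hmem⟩ := (Finset.all_card_le_biUnion_card_iff_exists_injective fam).1 hall
  have hl : ∀ u i, (f (Sum.inl (u, i))).1 = u ∧ (f (Sum.inl (u, i))).2 ∈ G.neighborFinset u := by
    intro u i
    have := hmem (Sum.inl (u, i))
    simp only [fam, Sum.elim_inl, Finset.mem_image] at this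
    obtain ⟨w, hw, h⟩ := this
    rw [← h]
    exact ⟨rfl, hw⟩
  have hr : ∀ w j, (f (Sum.inr ⟨w, j⟩)).2 = w ∧ (f (Sum.inr ⟨w, j⟩)).1 ∈ G.neighborFinset w := by
    intro w j
    have := hmem (Sum.inr ⟨w, j⟩)
    simp only [fam, Sum.elim_inr, Finset.mem_image] at this
    obtain ⟨u, hu, h⟩ := this
    rw [← h]
    exact ⟨rfl, hu⟩
  set t : V → Finset V := fun u => Finset.univ.image fun i => (f (Sum.inl (u, i))).2 with ht
  have htcard : ∀ v, (t v).card = k := fun v => by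
    rw [ht, Finset.card_image_of_injective, Finset.card_univ, Fintype.card_fin]
    intro i j hij
    have : f (Sum.inl (v, i)) = f (Sum.inl (v, j)) :=
      Prod.ext ((hl v i).1.trans (hl v j).1.symm) hij
    simpa using hf this
  -- The discarded arcs into w leave room for at most k kept ones; counting all kept arcs then
  -- forces equality.
  have hle : ∀ w ∈ Finset.univ, (Finset.univ.filter fun v => w ∈ t v).card ≤ k := by
    intro w _
    set R := Finset.univ.image fun j => (f (Sum.inr ⟨w, j⟩)).1 with hR
    have hRcard : R.card = G.degree w - k := by
      rw [hR, Finset.card_image_of_injective, Finset.card_univ, Fintype.card_fin]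
      intro i j hij
      have : f (Sum.inr ⟨w, i⟩) = f (Sum.inr ⟨w, j⟩) :=
        Prod.ext hij ((hr w i).1.trans (hr w j).1.symm)
      simpa using hf this
    have hdisj : Disjoint (Finset.univ.filter fun v => w ∈ t v) R := by
      rw [Finset.disjoint_left]
      intro v hv hv'
      simp only [ht, hR, Finset.mem_filter, Finset.mem_univ, true_and, Finset.mem_image] at hv hv'
      obtain ⟨i, hi⟩ := hv
      obtain ⟨j, hj⟩ := hv'
      have : f (Sum.inl (v, i)) = f (Sum.inr ⟨w, j⟩) :=
        Prod.ext ((hl v i).1.trans hj.symm) (hi.trans (hr w j).1.symm)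
      simpa using hf this
    have hsub : (Finset.univ.filter fun v => w ∈ t v) ∪ R ⊆ G.neighborFinset w := by
      intro v hv
      rcases Finset.mem_union.1 hv with hv | hv
      · simp only [ht, Finset.mem_filter, Finset.mem_univ, true_and, Finset.mem_image] at hv
        obtain ⟨i, rfl⟩ := hv
        have := (hl v i).2
        rw [SimpleGraph.mem_neighborFinset] at this ⊢
        exact this.symm
      · simp only [hR, Finset.mem_univ, true_and, Finset.mem_image] at hv
        obtain ⟨j, rfl⟩ := hv
        exact (hr w j).2
    have := Finset.card_le_card hsub
    rw [Finset.card_union_of_disjoint hdisj, hRcard, G.card_neighborFinset_eq_degree] at this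
    have := hkd w
    omega
  refine ⟨t, ?_, htcard, ?_⟩
  · intro v w hw
    simp only [ht, Finset.mem_univ, true_and, Finset.mem_image] at hw
    obtain ⟨i, rfl⟩ := hw
    exact (hl v i).2
  · have hsum : ∑ w, (Finset.univ.filter fun v => w ∈ t v).card = ∑ _w : V, k := by
      have := Finset.sum_card_bipartiteAbove_eq_sum_card_bipartiteBelow
        (s := (Finset.univ : Finset V)) (t := Finset.univ) (fun v w => w ∈ t v)
      simp only [Finset.bipartiteAbove, Finset.bipartiteBelow] at this
      rw [← this]
      refine Finset.sum_congr rfl fun v _ => ?_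
      rw [Finset.filter_univ_mem, htcard]
    intro w
    exact (Finset.sum_eq_sum_iff_of_le hle).1 hsum w (Finset.mem_univ w)

end DiracFactor

/-! ### Cutting short cycles out of cycle covers. -/

section CycleList

variable {V : Type*} [DecidableEq V]

theorem Equiv.Perm.IsCycle.exists_toList [Fintype V] {c : Equiv.Perm V} (hc : c.IsCycle) :
    ∃ v ∈ c.support, ∀ w, w = c.toList v → w.Nodup ∧ w.toFinset = c.support ∧
      w.formPerm = c ∧ w.length = c.support.card := by
  obtain ⟨v, hv⟩ := hc.nonempty_support
  have hcv : c.cycleOf v = c := hc.cycleOf_eq (Equiv.Perm.mem_support.1 hv)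
  refine ⟨v, hv, ?_⟩
  rintro _ rfl
  refine ⟨Equiv.Perm.nodup_toList _ _, ?_, ?_, ?_⟩
  · ext y
    rw [List.mem_toFinset, Equiv.Perm.mem_toList_iff]
    constructor
    · rintro ⟨h, -⟩
      exact h.mem_support_iff.1 hv
    · intro hy
      exact ⟨hc.sameCycle (Equiv.Perm.mem_support.1 hv) (Equiv.Perm.mem_support.1 hy), hv⟩
  · rw [Equiv.Perm.formPerm_toList, hcv]
  · rw [Equiv.Perm.length_toList, hcv]

/-- The walks `v = v₀, …, vₘ` with `vᵢ₊₁ ∈ t vᵢ`, as lists of vertices. -/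
def walksFrom (t : V → Finset V) : ℕ → V → Finset (List V)
  | 0, v => {[v]}
  | m + 1, v => (t v).biUnion fun u => (walksFrom t m u).image (v :: ·)

theorem card_walksFrom_le (t : V → Finset V) (k : ℕ) (ht : ∀ v, (t v).card = k) (m : ℕ) (v : V) :
    (walksFrom t m v).card ≤ k ^ m := by
  induction m generalizing v with
  | zero => simp [walksFrom]
  | succ m ih =>
    refine Finset.card_biUnion_le.trans ?_
    calc _ ≤ ∑ _u ∈ t v, k ^ m := Finset.sum_le_sum fun u _ => Finset.card_image_le.trans (ih u)
      _ = _ := by rw [Finset.sum_const, ht, smul_eq_mul, pow_succ, mul_comm]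

theorem length_of_mem_walksFrom (t : V → Finset V) (m : ℕ) (v : V) :
    ∀ w ∈ walksFrom t m v, w.length = m + 1 := by
  induction m generalizing v with
  | zero => simp [walksFrom]
  | succ m ih =>
    intro w hw
    simp only [walksFrom, Finset.mem_biUnion, Finset.mem_image] at hw
    obtain ⟨u, -, w', hw', rfl⟩ := hw
    simp [ih u w' hw']

theorem iterate_mem_walksFrom (t : V → Finset V) (f : V → V) (m : ℕ) (v : V)
    (h : ∀ j, f (f^[j] v) ∈ t (f^[j] v)) : List.iterate f v (m + 1) ∈ walksFrom t m v := by
  induction m generalizing v with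
  | zero => simp [walksFrom, List.iterate]
  | succ m ih =>
    rw [List.iterate, walksFrom, Finset.mem_biUnion]
    exact ⟨f v, h 0, Finset.mem_image_of_mem _ (ih (f v) fun j => by
      simpa [Function.iterate_succ_apply] using h (j + 1))⟩

variable [Fintype V]

/-- Permutations of `V` moving every vertex of `S` along an arc of `t` and fixing the others. -/
def partialCovers (t : V → Finset V) (S : Finset V) : Finset (Equiv.Perm V) :=
  Finset.univ.filter fun σ => (∀ v ∈ S, σ v ∈ t v) ∧ ∀ v ∉ S, σ v = v

theorem mem_partialCovers {t : V → Finset V} {S : Finset V} {σ : Equiv.Perm V} :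
    σ ∈ partialCovers t S ↔ (∀ v ∈ S, σ v ∈ t v) ∧ ∀ v ∉ S, σ v = v := by
  simp [partialCovers]

/-- Partial covers together with `i` distinct cycles of length at most `ℓ`. -/
def cycleTuples (t : V → Finset V) (ℓ i : ℕ) (S : Finset V) :
    Finset (Equiv.Perm V × (Fin i → Equiv.Perm V)) :=
  Finset.univ.filter fun x => x.1 ∈ partialCovers t S ∧ Function.Injective x.2 ∧
    ∀ a, x.2 a ∈ x.1.cycleFactorsFinset ∧ (x.2 a).support.card ≤ ℓ

theorem support_subset_of_mem_partialCovers {t : V → Finset V} {S : Finset V}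
    {σ c : Equiv.Perm V} (hσ : σ ∈ partialCovers t S) (hc : c ∈ σ.cycleFactorsFinset) :
    c.support ⊆ S := by
  refine (Equiv.Perm.mem_cycleFactorsFinset_support_le hc).trans fun v hv => ?_
  by_contra hvS
  exact Equiv.Perm.mem_support.1 hv ((mem_partialCovers.1 hσ).2 v hvS)

theorem mul_inv_mem_partialCovers {t : V → Finset V} {S : Finset V}
    {σ c : Equiv.Perm V} (hσ : σ ∈ partialCovers t S) (hc : c ∈ σ.cycleFactorsFinset) :
    σ * c⁻¹ ∈ partialCovers t (S \ c.support) := by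
  obtain ⟨h1, h2⟩ := mem_partialCovers.1 hσ
  have hd := Equiv.Perm.disjoint_mul_inv_of_mem_cycleFactorsFinset hc
  refine mem_partialCovers.2 ⟨fun v hv => ?_, fun v hv => ?_⟩
  · obtain ⟨hv1, hv2⟩ := Finset.mem_sdiff.1 hv
    have : c⁻¹ v = v := by
      rw [Equiv.Perm.inv_eq_iff_eq]
      exact (Equiv.Perm.notMem_support.1 hv2).symm
    rw [Equiv.Perm.mul_apply, this]
    exact h1 v hv1
  · by_cases hvc : v ∈ c.support
    · exact (hd v).resolve_right (Equiv.Perm.mem_support.1 hvc)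
    · have : c⁻¹ v = v := by
        rw [Equiv.Perm.inv_eq_iff_eq]
        exact (Equiv.Perm.notMem_support.1 hvc).symm
      rw [Equiv.Perm.mul_apply, this]
      exact h2 v fun hvS => hv (Finset.mem_sdiff.2 ⟨hvS, hvc⟩)

theorem exists_walk_of_mem_cycleFactorsFinset {t : V → Finset V} {S : Finset V}
    {σ c : Equiv.Perm V} (hσ : σ ∈ partialCovers t S) (hc : c ∈ σ.cycleFactorsFinset) :
    ∃ v m, m + 1 = c.support.card ∧ ∃ w ∈ walksFrom t m v, w.Nodup ∧ w.toFinset = c.support ∧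
      w.formPerm = c := by
  obtain ⟨hcyc, hcσ⟩ := Equiv.Perm.mem_cycleFactorsFinset_iff.1 hc
  obtain ⟨v, hv, h⟩ := hcyc.exists_toList
  obtain ⟨h1, h2, h3, h4⟩ := h _ rfl
  have hpos : 0 < c.support.card := Finset.card_pos.2 ⟨v, hv⟩
  refine ⟨v, c.support.card - 1, by omega, c.toList v, ?_, h1, h2, h3⟩
  have hcv : c.cycleOf v = c := hcyc.cycleOf_eq (Equiv.Perm.mem_support.1 hv)
  have := iterate_mem_walksFrom t c (c.support.card - 1) v (fun j => by
    have hj : c^[j] v ∈ c.support := by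
      rw [Equiv.Perm.iterate_eq_pow]
      exact Equiv.Perm.pow_apply_mem_support.2 hv
    rw [hcσ _ hj]
    exact (mem_partialCovers.1 hσ).1 _ (support_subset_of_mem_partialCovers hσ hc hj))
  rw [Nat.sub_add_cancel hpos] at this
  rwa [Equiv.Perm.toList, hcv]

/-- The first marked cycle is recorded as a walk through its vertices and removed. The walk
determines the cycle, so for a given walk the remaining tuple determines the original one. -/
theorem card_cycleTuples_succ_le (t : V → Finset V) (ℓ i : ℕ) (S : Finset V) :
    (cycleTuples t ℓ (i + 1) S).card ≤
      ∑ p ∈ (Finset.univ : Finset V) ×ˢ Finset.range ℓ,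
        ∑ w ∈ (walksFrom t p.2 p.1).filter fun w => w.Nodup ∧ w.toFinset ⊆ S,
          (cycleTuples t ℓ i (S \ w.toFinset)).card := by
  have hx : ∀ x ∈ cycleTuples t ℓ (i + 1) S, ∃ y : Σ _p : V × ℕ, List V,
      y ∈ ((Finset.univ : Finset V) ×ˢ Finset.range ℓ).sigma
        (fun p => (walksFrom t p.2 p.1).filter fun w => w.Nodup ∧ w.toFinset ⊆ S) ∧
      y.2.toFinset = (x.2 0).support ∧ y.2.formPerm = x.2 0 := by
    intro x hx
    simp only [cycleTuples, Finset.mem_filter, Finset.mem_univ, true_and] at hx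
    obtain ⟨hσ, -, hc⟩ := hx
    obtain ⟨v, m, hm, w, hw, h1, h2, h3⟩ :=
      exists_walk_of_mem_cycleFactorsFinset hσ (hc 0).1
    refine ⟨⟨(v, m), w⟩, ?_, h2, h3⟩
    simp only [Finset.mem_sigma, Finset.mem_product, Finset.mem_univ, true_and, Finset.mem_range,
      Finset.mem_filter]
    refine ⟨by have := (hc 0).2; omega, hw, h1, ?_⟩
    rw [h2]
    exact support_subset_of_mem_partialCovers hσ (hc 0).1
  rcases Finset.eq_empty_or_nonempty (cycleTuples t ℓ (i + 1) S) with h0 | ⟨x₀, hx₀⟩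
  · simp [h0]
  obtain ⟨y₀, -⟩ := hx x₀ hx₀
  have : Nonempty (Σ _p : V × ℕ, List V) := ⟨y₀⟩
  choose! φ hφ1 hφ2 hφ3 using hx
  rw [Finset.sum_sigma', Finset.card_eq_sum_card_fiberwise (f := φ)
    (t := ((Finset.univ : Finset V) ×ˢ Finset.range ℓ).sigma
        (fun p => (walksFrom t p.2 p.1).filter fun w => w.Nodup ∧ w.toFinset ⊆ S))
    (fun x hx => hφ1 x hx)]
  refine Finset.sum_le_sum fun y _ => ?_
  refine Finset.card_le_card_of_injOn (fun x => (x.1 * (x.2 0)⁻¹, Fin.tail x.2)) ?_ ?_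
  · intro x hx
    obtain ⟨hxm, rfl⟩ := Finset.mem_filter.1 (Finset.mem_coe.1 hx)
    have e := hφ2 x hxm
    simp only [cycleTuples, Finset.mem_filter, Finset.mem_univ, true_and] at hxm
    obtain ⟨hσ, hinj, hc⟩ := hxm
    simp only [cycleTuples, Finset.coe_filter, Finset.mem_univ, true_and, Set.mem_ofPred_eq]
    refine ⟨?_, ?_, fun a => ⟨?_, (hc _).2⟩⟩
    · rw [e]
      exact mul_inv_mem_partialCovers hσ (hc 0).1
    · exact hinj.comp (Fin.succ_injective _)
    · rw [Equiv.Perm.cycleFactorsFinset_mul_inv_mem_eq_sdiff (hc 0).1, Finset.mem_sdiff,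
        Finset.mem_singleton]
      exact ⟨(hc _).1, fun h => Fin.succ_ne_zero a (hinj h)⟩
  · intro x hx x' hx' h
    obtain ⟨hx, e⟩ := Finset.mem_filter.1 (Finset.mem_coe.1 hx)
    obtain ⟨hx', e'⟩ := Finset.mem_filter.1 (Finset.mem_coe.1 hx')
    have h0 : x.2 0 = x'.2 0 := by rw [← hφ3 x hx, ← hφ3 x' hx', e, e']
    simp only [Prod.mk.injEq] at h
    obtain ⟨h1, h2⟩ := h
    refine Prod.ext ?_ ?_
    · rw [h0] at h1
      exact mul_right_cancel h1
    · rw [← Fin.cons_self_tail x.2, ← Fin.cons_self_tail x'.2, h0, h2]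

/-- T collects the vertices removed so far, each carrying weight k. A cycle of length m + 1 has at
most n k^m walks against the weight k^(m+1), so each of the ℓ possible lengths costs n/k. -/
theorem card_cycleTuples_le (t : V → Finset V) (k : ℕ) (hk : 0 < k) (ht : ∀ v, (t v).card = k)
    (ℓ M : ℕ) (D : ℝ) (hD : ∀ T : Finset V, T.card ≤ M →
      (k : ℝ) ^ T.card * (partialCovers t Tᶜ).card ≤ D) (i : ℕ) (T : Finset V)
    (hT : T.card + i * ℓ ≤ M) :
    (k : ℝ) ^ T.card * (cycleTuples t ℓ i Tᶜ).card ≤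
      ((Fintype.card V : ℝ) * ℓ / k) ^ i * D := by
  induction i generalizing T with
  | zero =>
    rw [pow_zero, one_mul]
    refine le_trans (mul_le_mul_of_nonneg_left ?_ (by positivity)) (hD T (by omega))
    norm_cast
    refine Finset.card_le_card_of_injOn Prod.fst ?_ ?_
    · intro x hx
      simp only [cycleTuples, Finset.coe_filter, Finset.mem_univ, true_and, Set.mem_ofPred_eq] at hx
      exact hx.1
    · intro x _ y _ h
      exact Prod.ext h (Subsingleton.elim _ _)
  | succ i ih =>
    have hk' : (0 : ℝ) < k := by exact_mod_cast hk
    have hD0 : 0 ≤ D := le_trans (by positivity) (hD ∅ (by simp))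
    have h1 : ((cycleTuples t ℓ (i + 1) Tᶜ).card : ℝ) ≤ _ :=
      Nat.cast_le.2 (card_cycleTuples_succ_le t ℓ i Tᶜ)
    push_cast at h1
    set B : ℝ := ((Fintype.card V : ℝ) * ℓ / k) ^ i * D with hB
    have hB0 : 0 ≤ B := by positivity
    have h2 : ∀ p ∈ (Finset.univ : Finset V) ×ˢ Finset.range ℓ,
        ∑ w ∈ (walksFrom t p.2 p.1).filter (fun w => w.Nodup ∧ w.toFinset ⊆ Tᶜ),
          ((cycleTuples t ℓ i (Tᶜ \ w.toFinset)).card : ℝ) ≤ B / k ^ (T.card + 1) := by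
      rintro ⟨v, m⟩ hp
      have hm : m < ℓ := by simpa using hp
      have h3 : ∀ w ∈ (walksFrom t m v).filter (fun w => w.Nodup ∧ w.toFinset ⊆ Tᶜ),
          ((cycleTuples t ℓ i (Tᶜ \ w.toFinset)).card : ℝ) ≤ B / k ^ (T.card + (m + 1)) := by
        intro w hw
        obtain ⟨hw, hnd, hsub⟩ := Finset.mem_filter.1 hw
        have hcard : (T ∪ w.toFinset).card = T.card + (m + 1) := by
          rw [Finset.card_union_of_disjoint, List.toFinset_card_of_nodup hnd,
            length_of_mem_walksFrom t m v w hw]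
          rw [Finset.disjoint_left]
          intro x hx hx'
          exact Finset.mem_compl.1 (hsub hx') hx
        have := ih (T ∪ w.toFinset) (by rw [hcard]; nlinarith)
        rw [hcard] at this
        rw [le_div_iff₀ (by positivity), mul_comm,
          show Tᶜ \ w.toFinset = (T ∪ w.toFinset)ᶜ by
            rw [Finset.compl_union, Finset.sdiff_eq_inter_compl]]
        exact this
      refine (Finset.sum_le_card_nsmul _ _ _ h3).trans ?_
      rw [nsmul_eq_mul]
      have h4 : (((walksFrom t m v).filter (fun w => w.Nodup ∧ w.toFinset ⊆ Tᶜ)).card : ℝ) ≤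
          k ^ m := by
        exact_mod_cast (Finset.card_filter_le _ _).trans (card_walksFrom_le t k ht m v)
      calc _ ≤ (k : ℝ) ^ m * (B / k ^ (T.card + (m + 1))) :=
            mul_le_mul_of_nonneg_right h4 (by positivity)
        _ = _ := by
          rw [show T.card + (m + 1) = m + (T.card + 1) by ring, pow_add (k : ℝ) m]
          field_simp
    have h5 := h1.trans (Finset.sum_le_card_nsmul _ _ _ h2)
    rw [Finset.card_product, Finset.card_univ, Finset.card_range, nsmul_eq_mul] at h5
    calc _ ≤ (k : ℝ) ^ T.card * (((Fintype.card V * ℓ : ℕ) : ℝ) * (B / k ^ (T.card + 1))) :=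
          mul_le_mul_of_nonneg_left h5 (by positivity)
      _ = _ := by
        rw [hB, pow_succ, pow_succ]
        push_cast
        field_simp

/-- The covers of `V` by cycles of `t`, at least `j` of which have length at most `ℓ`. -/
def manyShortCycles (t : V → Finset V) (ℓ j : ℕ) : Finset (Equiv.Perm V) :=
  (partialCovers t Finset.univ).filter fun σ =>
    j ≤ (σ.cycleFactorsFinset.filter fun c => c.support.card ≤ ℓ).card

/-- Any j short cycles of a cover can be marked in j! orders; this factorial is what makes the bound
on covers with many short cycles small. -/
theorem card_manyShortCycles_mul_le (t : V → Finset V) (ℓ j : ℕ) :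
    (manyShortCycles t ℓ j).card * j.factorial ≤ (cycleTuples t ℓ j Finset.univ).card := by
  rw [← smul_eq_mul]
  refine le_trans ?_ (Finset.card_le_card (Finset.filter_subset
    (fun x => x.1 ∈ manyShortCycles t ℓ j) _))
  rw [Finset.card_eq_sum_card_fiberwise (f := Prod.fst)
    (s := (cycleTuples t ℓ j Finset.univ).filter fun x => x.1 ∈ manyShortCycles t ℓ j)
    (t := manyShortCycles t ℓ j) (fun x hx => (Finset.mem_filter.1 hx).2)]
  refine Finset.card_nsmul_le_sum _ _ _ fun σ hσ => ?_
  obtain ⟨hσ1, hσ2⟩ := Finset.mem_filter.1 hσ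
  obtain ⟨C, hC, hCcard⟩ := Finset.exists_subset_card_eq hσ2
  let e : Fin j ≃ C := (Fintype.equivFinOfCardEq (by simpa using hCcard)).symm
  have : j.factorial = (Finset.univ : Finset (Equiv.Perm (Fin j))).card := by
    rw [Finset.card_univ, Fintype.card_perm, Fintype.card_fin]
  rw [this]
  refine Finset.card_le_card_of_injOn (fun π => (σ, fun a => (e (π a)).1)) ?_ ?_
  · intro π _
    simp only [cycleTuples, Finset.coe_filter, Finset.mem_filter, Finset.mem_univ, true_and,
      Set.mem_ofPred_eq]
    refine ⟨⟨⟨hσ1, ?_, fun a => ?_⟩, hσ⟩, trivial⟩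
    · exact Subtype.val_injective.comp (e.injective.comp π.injective)
    · simpa using hC (e (π a)).2
  · intro π _ π' _ h
    ext a
    simp only [Prod.mk.injEq, true_and] at h
    have := congrFun h a
    exact congrArg Fin.val (e.injective (Subtype.ext this))

end CycleList

/-! ### Bregman's bound for covers of all but a few vertices. -/

section PartialCoverBound

theorem log_factorial_le (r : ℕ) (hr : 1 ≤ r) :
    Real.log (r.factorial : ℝ) ≤ (r + 1) * Real.log r - r + 1 := by
  induction r, hr using Nat.le_induction with
  | base => simp
  | succ r hr ih =>
    have hr' : (0 : ℝ) < r := by exact_mod_cast hr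
    rw [Nat.factorial_succ]
    push_cast
    rw [Real.log_mul (by positivity) (by positivity)]
    have h1 := Real.one_sub_inv_le_log_of_pos (x := ((r : ℝ) + 1) / r) (by positivity)
    rw [Real.log_div (by positivity) (by positivity), inv_div] at h1
    have h2 : (r + 1 : ℝ) * (1 - r / (r + 1)) = 1 := by field_simp; ring
    nlinarith [mul_le_mul_of_nonneg_left h1 (by positivity : (0 : ℝ) ≤ r + 1)]

/-- Stirling's bound followed by the tangent line of log at k, so that the lost out-degrees k - r
enter linearly and can be summed over all vertices. -/
theorem logFactorialMean_le (r k : ℕ) (hr : 0 < r) (hrk : r ≤ k) (hkr : k ≤ 2 * r) :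
    logFactorialMean r ≤
      Real.log k + ((r : ℝ) - k) / k - 1 + 2 / k * (1 + Real.log k) := by
  have hr' : (0 : ℝ) < r := by exact_mod_cast hr
  have hk' : (0 : ℝ) < k := by exact_mod_cast hr.trans_le hrk
  have hlogk : 0 ≤ Real.log k := Real.log_nonneg (by exact_mod_cast hr.trans_le hrk)
  have hrk' : (r : ℝ) ≤ k := by exact_mod_cast hrk
  have hkr' : (k : ℝ) ≤ 2 * r := by exact_mod_cast hkr
  have h1 : Real.log r ≤ Real.log k + ((r : ℝ) - k) / k := by
    have := Real.log_le_sub_one_of_pos (x := (r : ℝ) / k) (by positivity)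
    rw [Real.log_div hr'.ne' hk'.ne'] at this
    have h2 : (r : ℝ) / k - 1 = (r - k) / k := by field_simp
    linarith
  have h2 : Real.log r ≤ Real.log k := Real.log_le_log hr' hrk'
  have h3 : (1 + Real.log r) / r ≤ 2 / k * (1 + Real.log k) := by
    calc (1 + Real.log r) / r ≤ (1 + Real.log k) / r := by gcongr
      _ = 1 / r * (1 + Real.log k) := by ring
      _ ≤ _ := by
        refine mul_le_mul_of_nonneg_right ?_ (by positivity)
        rw [div_le_div_iff₀ hr' hk']
        linarith
  have h4 : logFactorialMean r ≤ Real.log r - 1 + (1 + Real.log r) / r := by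
    rw [logFactorialMean, div_le_iff₀ hr']
    have := log_factorial_le r hr
    have e : (Real.log r - 1 + (1 + Real.log r) / r) * r = (r + 1) * Real.log r - r + 1 := by
      field_simp
      ring
    linarith
  linarith

variable {V : Type*} [Fintype V] [DecidableEq V]

theorem card_partialCovers_le_card_equivsIn (t : V → Finset V) (S : Finset V) :
    (partialCovers t S).card ≤
      (equivsIn fun x : {x // x ∈ S} => (t x).subtype (· ∈ S)).card := by
  rw [← Finset.card_attach]
  have hS : ∀ σ ∈ partialCovers t S, ∀ x, x ∈ S ↔ σ x ∈ S := by
    intro σ hσ x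
    have h := (mem_partialCovers.1 hσ).2
    constructor
    · intro hx
      by_contra hx'
      have := σ.injective (h _ hx')
      rw [this] at hx'
      exact hx' hx
    · intro hx
      by_contra hx'
      rw [h x hx'] at hx
      exact hx' hx
  refine Finset.card_le_card_of_injOn
    (fun σ => σ.1.subtypeEquiv (p := (· ∈ S)) (q := (· ∈ S)) (hS σ.1 σ.2)) ?_ ?_
  · intro σ _
    have := (mem_partialCovers.1 σ.2).1
    simp only [equivsIn, Finset.coe_filter, Finset.mem_univ, true_and, Set.mem_ofPred_eq]
    rintro ⟨x, hx⟩
    simpa using this x hx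
  · intro σ _ τ _ hστ
    refine Subtype.ext (Equiv.ext fun x => ?_)
    by_cases hx : x ∈ S
    · simpa using congrArg Subtype.val (Equiv.congr_fun hστ ⟨x, hx⟩)
    · rw [(mem_partialCovers.1 σ.2).2 x hx, (mem_partialCovers.1 τ.2).2 x hx]

/-- Deleting T costs the other vertices at least k|T| - |T|² out-arcs, since in-degrees are k. The
linear term then contributes a factor of about e^(-|T|), and with the weight k^|T| the main term is
again (k/e)^n. -/
theorem card_partialCovers_compl_le (t : V → Finset V) (k : ℕ) (hk : 0 < k)
    (hout : ∀ v, (t v).card = k) (hin : ∀ w, (Finset.univ.filter fun v => w ∈ t v).card = k)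
    (T : Finset V) (hT : 2 * T.card ≤ k) :
    (k : ℝ) ^ T.card * (partialCovers t Tᶜ).card ≤
      ((k : ℝ) * Real.exp (-1)) ^ Fintype.card V *
        Real.exp ((T.card : ℝ) ^ 2 / k + 2 * Fintype.card V / k * (1 + Real.log k)) := by
  have hk' : (0 : ℝ) < k := by exact_mod_cast hk
  have hlogk : 0 ≤ Real.log k := Real.log_nonneg (by exact_mod_cast hk)
  rcases Nat.eq_zero_or_pos (partialCovers t Tᶜ).card with h0 | h0
  · rw [h0]; simp; positivity
  have hle := card_partialCovers_le_card_equivsIn t Tᶜ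
  have hbreg := log_card_equivsIn_le _ (Finset.card_pos.1 (h0.trans_le hle))
  have hlog : Real.log (partialCovers t Tᶜ).card ≤ _ :=
    (Real.log_le_log (by exact_mod_cast h0) (by exact_mod_cast hle)).trans hbreg
  have hcard : ∀ x : {x // x ∈ Tᶜ}, ((t x).subtype (· ∈ Tᶜ)).card = (t x ∩ Tᶜ).card := fun x => by
    rw [Finset.card_subtype, Finset.filter_mem_eq_inter]
  simp_rw [hcard] at hlog
  rw [← Finset.sum_subtype Tᶜ (fun _ => Iff.rfl)
    (fun x => logFactorialMean (t x ∩ Tᶜ).card)] at hlog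
  have hsplit : ∀ x, (t x ∩ Tᶜ).card + (t x ∩ T).card = k := fun x => by
    rw [← hout x, add_comm, ← Finset.sdiff_eq_inter_compl, Finset.card_inter_add_card_sdiff]
  have hsmall : ∀ x, (t x ∩ T).card ≤ T.card := fun x =>
    Finset.card_le_card Finset.inter_subset_right
  have hterm : ∀ x ∈ Tᶜ, logFactorialMean (t x ∩ Tᶜ).card ≤
      Real.log k - 1 + 2 / k * (1 + Real.log k) - ((t x ∩ T).card : ℝ) / k := fun x _ => by
    have h1 := hsplit x
    have h2 := hsmall x
    refine (logFactorialMean_le _ k (by omega) (by omega) (by omega)).trans (le_of_eq ?_)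
    have h3 : (((t x ∩ Tᶜ).card : ℝ) - k) = -((t x ∩ T).card : ℝ) := by
      have : ((t x ∩ Tᶜ).card : ℝ) + ((t x ∩ T).card : ℝ) = k := by exact_mod_cast h1
      linarith
    rw [h3]
    ring
  have hcross : (k : ℝ) * T.card ≤ ∑ x ∈ Tᶜ, ((t x ∩ T).card : ℝ) + (T.card : ℝ) ^ 2 := by
    have h1 : ∑ x, (t x ∩ T).card = k * T.card := by
      have := Finset.sum_card_bipartiteAbove_eq_sum_card_bipartiteBelow
        (s := (Finset.univ : Finset V)) (t := T) (fun v w => w ∈ t v)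
      simp only [Finset.bipartiteAbove, Finset.bipartiteBelow] at this
      rw [Finset.sum_congr rfl (fun w _ => hin w), Finset.sum_const, smul_eq_mul] at this
      rw [mul_comm, ← this]
      refine Finset.sum_congr rfl fun x _ => congrArg _ ?_
      ext w
      simp [and_comm]
    have h2 : ∑ x ∈ T, (t x ∩ T).card ≤ T.card ^ 2 := by
      refine (Finset.sum_le_card_nsmul _ _ _ fun x _ => hsmall x).trans (le_of_eq ?_)
      rw [smul_eq_mul, sq]
    have h3 := Finset.sum_add_sum_compl T fun x => (t x ∩ T).card
    have : k * T.card ≤ ∑ x ∈ Tᶜ, (t x ∩ T).card + T.card ^ 2 := by omega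
    exact_mod_cast this
  have hmain := hlog.trans (Finset.sum_le_sum hterm)
  rw [Finset.sum_sub_distrib, Finset.sum_const, nsmul_eq_mul, ← Finset.sum_div] at hmain
  have hcompl : ((Tᶜ.card : ℕ) : ℝ) = Fintype.card V - T.card := by
    have := Finset.card_add_card_compl T
    have h' : (T.card : ℝ) + (Tᶜ.card : ℝ) = Fintype.card V := by exact_mod_cast this
    linarith
  have hcross' : (T.card : ℝ) - (T.card : ℝ) ^ 2 / k ≤ (∑ x ∈ Tᶜ, ((t x ∩ T).card : ℝ)) / k := by
    rw [le_div_iff₀ hk', sub_mul, div_mul_cancel₀ _ hk'.ne']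
    linarith
  have herr : ((Fintype.card V : ℝ) - T.card) * (2 / k * (1 + Real.log k)) ≤
      2 * Fintype.card V / k * (1 + Real.log k) := by
    have : 0 ≤ (T.card : ℝ) * (2 / k * (1 + Real.log k)) := by positivity
    have e : 2 * (Fintype.card V : ℝ) / k * (1 + Real.log k) =
      Fintype.card V * (2 / k * (1 + Real.log k)) := by ring
    rw [e]
    linarith
  rw [hcompl] at hmain
  have hfinal : Real.log (partialCovers t Tᶜ).card ≤
      (Fintype.card V - T.card) * Real.log k - Fintype.card V + ((T.card : ℝ) ^ 2 / k +
        2 * Fintype.card V / k * (1 + Real.log k)) := by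
    nlinarith
  have hpos : (0 : ℝ) < (partialCovers t Tᶜ).card := by exact_mod_cast h0
  have hexp := (Real.log_le_iff_le_exp hpos).1 hfinal
  have hkexp : ∀ m : ℕ, (k : ℝ) ^ m = Real.exp (m * Real.log k) := fun m => by
    rw [← Real.log_pow, Real.exp_log (by positivity)]
  calc _ ≤ (k : ℝ) ^ T.card * _ := mul_le_mul_of_nonneg_left hexp (by positivity)
    _ = _ := by
      rw [mul_pow, hkexp, hkexp, ← Real.exp_nat_mul, ← Real.exp_add, ← Real.exp_add,
        ← Real.exp_add]
      congr 1
      ring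

/-- Few cycle covers of a dense regular directed graph have many short cycles. -/
theorem card_manyShortCycles_le (t : V → Finset V) (k : ℕ) (hk : 0 < k)
    (hout : ∀ v, (t v).card = k) (hin : ∀ w, (Finset.univ.filter fun v => w ∈ t v).card = k)
    (ℓ j : ℕ) (h : 2 * (j * ℓ) ≤ k) :
    ((manyShortCycles t ℓ j).card : ℝ) * j.factorial ≤
      ((Fintype.card V : ℝ) * ℓ / k) ^ j * (((k : ℝ) * Real.exp (-1)) ^ Fintype.card V *
        Real.exp (((j * ℓ : ℕ) : ℝ) ^ 2 / k + 2 * Fintype.card V / k * (1 + Real.log k))) := by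
  have h1 := card_cycleTuples_le t k hk hout ℓ (j * ℓ)
    (((k : ℝ) * Real.exp (-1)) ^ Fintype.card V * Real.exp (((j * ℓ : ℕ) : ℝ) ^ 2 / k +
      2 * Fintype.card V / k * (1 + Real.log k))) (fun T hT =>
    (card_partialCovers_compl_le t k hk hout hin T (by omega)).trans (by
      have : (T.card : ℝ) ≤ ((j * ℓ : ℕ) : ℝ) := Nat.cast_le.2 hT
      gcongr)) j ∅ (by simp)
  simp only [Finset.card_empty, pow_zero, one_mul, Finset.compl_empty] at h1
  refine le_trans ?_ h1
  exact_mod_cast card_manyShortCycles_mul_le t ℓ j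

end PartialCoverBound

/-! ### Closed polygons and Ore's rotations. -/

section ListCycles

/-- The edges between consecutive entries of a list. -/
def List.pathEdges {V : Type*} : List V → List (Sym2 V)
  | a :: b :: l => s(a, b) :: List.pathEdges (b :: l)
  | _ => []

/-- The edges of the closed polygon through the entries of a list. -/
def List.cycleEdges {V : Type*} : List V → List (Sym2 V)
  | [] => []
  | a :: l => List.pathEdges (a :: l ++ [a])

variable {V : Type*}

theorem List.pathEdges_concat_append_cons (l m : List V) (u v : V) :
    List.pathEdges (l ++ [u] ++ v :: m) =
      List.pathEdges (l ++ [u]) ++ s(u, v) :: List.pathEdges (v :: m) := by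
  induction l with
  | nil => simp [List.pathEdges]
  | cons a l ih =>
    rcases l with _ | ⟨b, l⟩
    · simp [List.pathEdges]
    · simpa [List.pathEdges] using ih

theorem List.pathEdges_reverse (l : List V) :
    List.pathEdges l.reverse = (List.pathEdges l).reverse := by
  induction l with
  | nil => simp [List.pathEdges]
  | cons a l ih =>
    rcases l with _ | ⟨b, l⟩
    · simp [List.pathEdges]
    · rw [List.reverse_cons, List.reverse_cons, List.pathEdges_concat_append_cons,
        ← List.reverse_cons, ih]
      simp [List.pathEdges, Sym2.eq_swap]

theorem List.mem_of_mem_pathEdges {l : List V} {e : Sym2 V} (he : e ∈ List.pathEdges l) :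
    ∃ p u v q, l = p ++ [u] ++ v :: q ∧ e = s(u, v) := by
  induction l with
  | nil => simp [List.pathEdges] at he
  | cons a l ih =>
    rcases l with _ | ⟨b, l⟩
    · simp [List.pathEdges] at he
    · rw [List.pathEdges, List.mem_cons] at he
      rcases he with rfl | he
      · exact ⟨[], a, b, l, rfl, rfl⟩
      · obtain ⟨p, u, v, q, h, rfl⟩ := ih he
        exact ⟨a :: p, u, v, q, by rw [h]; rfl, rfl⟩

theorem List.countP_pathEdges_append_le (Q : Sym2 V → Bool) (l m : List V) :
    (List.pathEdges (l ++ m)).countP Q ≤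
      (List.pathEdges l).countP Q + (List.pathEdges m).countP Q + 1 := by
  rcases l.eq_nil_or_concat with rfl | ⟨l, u, rfl⟩
  · simp [List.pathEdges]
  rcases m with _ | ⟨v, m⟩
  · simp [List.pathEdges]
  · rw [List.concat_eq_append, List.pathEdges_concat_append_cons, List.countP_append, List.countP_cons]
    split_ifs <;> omega

/-- The cycle edges of a list cut into two nonempty pieces. -/
theorem List.cycleEdges_append (a u v z : V) (X' X'' Y' Y'' : List V) (hX : a :: X' = X'' ++ [u])
    (hY : v :: Y' = Y'' ++ [z]) :
    List.cycleEdges ((X'' ++ [u]) ++ (Y'' ++ [z])) = List.pathEdges (X'' ++ [u]) ++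
      s(u, v) :: (List.pathEdges (Y'' ++ [z]) ++ [s(z, a)]) := by
  have h1 : X'' ++ [u] ++ (Y'' ++ [z]) = a :: (X' ++ (Y'' ++ [z])) := by
    rw [← hX]; rfl
  rw [h1, List.cycleEdges, ← h1, ← hY, List.append_assoc, List.cons_append,
    List.pathEdges_concat_append_cons, ← List.cons_append, hY, List.pathEdges_concat_append_cons]
  rfl

theorem List.cycleEdges_append_perm (x y : List V) :
    (List.cycleEdges (x ++ y)).Perm (List.cycleEdges (y ++ x)) := by
  rcases x.eq_nil_or_concat with rfl | ⟨X'', u, hx⟩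
  · simp
  rcases y.eq_nil_or_concat with rfl | ⟨Y'', z, hy⟩
  · simp
  rcases x with _ | ⟨a, X'⟩
  · simp at hx
  rcases y with _ | ⟨v, Y'⟩
  · simp at hy
  rw [List.concat_eq_append] at hx hy
  rw [hx, hy, List.cycleEdges_append a u v z X' X'' Y' Y'' hx hy,
    List.cycleEdges_append v z a u Y' Y'' X' X'' hy hx]
  classical
  rw [List.perm_iff_count]
  intro e
  simp only [List.count_append, List.count_cons, List.count_nil]
  omega

variable [Fintype V] [DecidableEq V] (G : SimpleGraph V) [DecidableRel G.Adj]

/-- In a graph of minimum degree at least `n / 2`, any Hamilton path with ends `a`, `z` has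
consecutive vertices `u`, `v` such that `u` is adjacent to `z` and `v` is adjacent to `a`. -/
theorem exists_crossing (hG : ∀ v, Fintype.card V ≤ 2 * G.degree v) (l : List V) (hl : l.Nodup)
    (hall : ∀ v, v ∈ l) (a z : V) (m m' : List V) (ha : l = a :: m) (hz : l = m' ++ [z]) :
    ∃ p u v q, l = p ++ [u] ++ v :: q ∧ G.Adj u z ∧ G.Adj v a := by
  have hlen : l.length = Fintype.card V := by
    rw [← List.toFinset_card_of_nodup hl, ← Finset.card_univ]
    congr 1
    ext v
    simp [hall v]
  set n := Fintype.card V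
  set f : ℕ → V := fun i => l.getD i a with hf
  have hf0 : f 0 = a := by simp [hf, ha]
  have hfz : f (n - 1) = z := by
    have : n - 1 = m'.length := by rw [← hlen, hz]; simp
    rw [this]
    simp [hf, hz]
  have hsurj : ∀ v, ∃ i < n, f i = v := fun v => by
    obtain ⟨i, hi, h⟩ := List.getElem_of_mem (hall v)
    refine ⟨i, hlen ▸ hi, ?_⟩
    rw [hf, ← h]
    exact List.getD_eq_getElem _ _ hi
  -- Both index sets lie among n - 1 positions and their sizes add up to at least n, so they meet.
  -- The index in A is shifted by one, as it names the predecessor of a neighbour of `a`.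
  set A := (Finset.range (n - 1)).filter fun i => G.Adj (f (i + 1)) a with hA
  set B := (Finset.range (n - 1)).filter fun i => G.Adj (f i) z with hB
  have hAcard : G.degree a ≤ A.card := by
    rw [← G.card_neighborFinset_eq_degree]
    refine (Finset.card_le_card (t := A.image fun i => f (i + 1)) ?_).trans Finset.card_image_le
    intro v hv
    rw [SimpleGraph.mem_neighborFinset] at hv
    obtain ⟨i, hi, rfl⟩ := hsurj v
    rcases i with _ | i
    · rw [hf0] at hv; exact absurd hv (G.irrefl)
    · refine Finset.mem_image.2 ⟨i, ?_, rfl⟩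
      rw [hA, Finset.mem_filter, Finset.mem_range]
      exact ⟨by omega, hv.symm⟩
  have hBcard : G.degree z ≤ B.card := by
    rw [← G.card_neighborFinset_eq_degree]
    refine (Finset.card_le_card (t := B.image f) ?_).trans Finset.card_image_le
    intro v hv
    rw [SimpleGraph.mem_neighborFinset] at hv
    obtain ⟨i, hi, rfl⟩ := hsurj v
    by_cases hin : i = n - 1
    · rw [hin, hfz] at hv; exact absurd hv (G.irrefl)
    · refine Finset.mem_image.2 ⟨i, ?_, rfl⟩
      rw [hB, Finset.mem_filter, Finset.mem_range]
      exact ⟨by omega, hv.symm⟩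
  have hnpos : 0 < n := Fintype.card_pos_iff.2 ⟨a⟩
  have hAB : (A ∩ B).Nonempty := by
    rw [← Finset.card_pos]
    have h1 := Finset.card_union_add_card_inter A B
    have h2 : (A ∪ B).card ≤ n - 1 := by
      have : A ∪ B ⊆ Finset.range (n - 1) :=
        Finset.union_subset (Finset.filter_subset _ _) (Finset.filter_subset _ _)
      simpa using Finset.card_le_card this
    have h3 := hG a
    have h4 := hG z
    omega
  obtain ⟨i, hi⟩ := hAB
  simp only [hA, hB, Finset.mem_inter, Finset.mem_filter, Finset.mem_range] at hi
  obtain ⟨⟨hin, hia⟩, -, hiz⟩ := hi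
  have hi1 : i < l.length := by omega
  have hi2 : i + 1 < l.length := by omega
  refine ⟨l.take i, f i, f (i + 1), l.drop (i + 2), ?_, hiz, hia⟩
  simp only [hf, List.getD_eq_getElem _ _ hi1, List.getD_eq_getElem _ _ hi2]
  rw [List.append_assoc, List.singleton_append, ← List.drop_eq_getElem_cons hi2,
    ← List.drop_eq_getElem_cons hi1, List.take_append_drop]

/-- One rotation step in Ore's argument. -/
theorem exists_cycleEdges_countP_lt (hG : ∀ v, Fintype.card V ≤ 2 * G.degree v) (l : List V)
    (hl : l.Nodup) (hall : ∀ v, v ∈ l) (h : 0 < l.cycleEdges.countP (· ∉ G.edgeSet)) :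
    ∃ l' : List V, l'.Nodup ∧ (∀ v, v ∈ l') ∧
      l'.cycleEdges.countP (· ∉ G.edgeSet) < l.cycleEdges.countP (· ∉ G.edgeSet) ∧
      ∀ Q : Sym2 V → Bool, l'.cycleEdges.countP Q ≤ l.cycleEdges.countP Q + 2 := by
  -- rotate so that the missing edge joins the last entry to the first
  have key : ∃ L : List V, L.Perm l ∧ L.cycleEdges.Perm l.cycleEdges ∧
      ∃ a z m m', L = a :: m ∧ L = m' ++ [z] ∧ ¬ G.Adj z a := by
    obtain ⟨e, he, hbad⟩ := List.countP_pos_iff.1 h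
    rcases l with _ | ⟨a, l⟩
    · simp [List.cycleEdges] at he
    obtain ⟨p, u, v, q, hp, rfl⟩ := List.mem_of_mem_pathEdges he
    have hbad' : ¬ G.Adj u v := by simpa using hbad
    rcases q.eq_nil_or_concat with rfl | ⟨q', b, rfl⟩
    · have h1 := List.append_inj' hp rfl
      refine ⟨a :: l, List.Perm.refl _, List.Perm.refl _, a, u, l, p, rfl, h1.1, ?_⟩
      have : a = v := by simpa using h1.2
      rwa [this]
    · rw [List.concat_eq_append, ← List.cons_append, ← List.append_assoc] at hp
      have h1 := (List.append_inj' hp rfl).1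
      refine ⟨(v :: q') ++ (p ++ [u]), ?_, ?_, v, u, q' ++ (p ++ [u]), v :: q' ++ p, rfl, by simp,
        hbad'⟩
      · rw [h1]; exact List.perm_append_comm
      · rw [h1]; exact List.cycleEdges_append_perm _ _
  obtain ⟨L, hLl, hLe, a, z, m, m', ha, hz, hza⟩ := key
  have hLnd : L.Nodup := hLl.nodup_iff.2 hl
  have hLall : ∀ v, v ∈ L := fun v => hLl.mem_iff.2 (hall v)
  obtain ⟨p, u, v, q, hL, huz, hva⟩ := exists_crossing G hG L hLnd hLall a z m m' ha hz
  obtain ⟨X', hX⟩ : ∃ X', a :: X' = p ++ [u] := by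
    rcases p with _ | ⟨b, p⟩
    · rw [ha] at hL
      simp only [List.nil_append, List.cons_append, List.cons.injEq] at hL
      exact ⟨[], by simp [hL.1]⟩
    · rw [ha] at hL
      simp only [List.cons_append, List.cons.injEq] at hL
      exact ⟨p ++ [u], by simp [hL.1]⟩
  obtain ⟨Y'', hY⟩ : ∃ Y'', v :: q = Y'' ++ [z] := by
    rcases (v :: q).eq_nil_or_concat with h0 | ⟨Y'', z', h0⟩
    · simp at h0
    · rw [List.concat_eq_append] at h0
      rw [hz, h0, ← List.append_assoc] at hL
      have := (List.append_inj' hL rfl).2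
      simp only [List.cons.injEq, and_true] at this
      exact ⟨Y'', by rw [h0, this]⟩
  have hold : L.cycleEdges = List.pathEdges (p ++ [u]) ++
      s(u, v) :: (List.pathEdges (v :: q) ++ [s(z, a)]) := by
    rw [hL, hY]
    exact List.cycleEdges_append a u v z X' p q Y'' hX hY
  -- Reversing the second piece trades uv and the non-edge za for the edges uz and va, and changes
  -- nothing else.
  have hnew : ((p ++ [u]) ++ (v :: q).reverse).cycleEdges = List.pathEdges (p ++ [u]) ++
      s(u, z) :: ((List.pathEdges (v :: q)).reverse ++ [s(v, a)]) := by
    rw [← List.pathEdges_reverse, List.reverse_cons]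
    refine List.cycleEdges_append a u z v X' p Y''.reverse q.reverse hX ?_
    rw [← List.reverse_cons, hY]
    simp
  refine ⟨(p ++ [u]) ++ (v :: q).reverse, ?_, ?_, ?_, ?_⟩
  · rw [hL] at hLnd
    exact ((List.reverse_perm (v :: q)).append_left (p ++ [u])).nodup_iff.2 hLnd
  · intro w
    have := hLall w
    rw [hL] at this
    exact ((List.reverse_perm (v :: q)).append_left (p ++ [u])).mem_iff.2 this
  · rw [← hLe.countP_eq, hold, hnew]
    have e1 : s(u, z) ∈ G.edgeSet := huz
    have e2 : s(v, a) ∈ G.edgeSet := hva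
    have e3 : s(z, a) ∉ G.edgeSet := hza
    simp only [List.countP_append, List.countP_cons, List.countP_reverse, List.countP_nil, e1, e2,
      e3, not_true_eq_false, not_false_eq_true, decide_true, decide_false, if_true]
    simp
    split_ifs <;> omega
  · intro Q
    rw [← hLe.countP_eq, hold, hnew]
    simp only [List.countP_append, List.countP_cons, List.countP_reverse, List.countP_nil]
    split_ifs <;> omega

/-- Each rotation removes a non-edge and introduces only two new edges. The predicate `Q` will mark
the edges outside the given cycle cover. -/
theorem exists_cycleEdges_subset (hG : ∀ v, Fintype.card V ≤ 2 * G.degree v)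
    (Q : Sym2 V → Bool) (b : ℕ) (l : List V)
    (hl : l.Nodup) (hall : ∀ v, v ∈ l) (h : l.cycleEdges.countP (· ∉ G.edgeSet) ≤ b) :
    ∃ l' : List V, l'.Nodup ∧ (∀ v, v ∈ l') ∧ (∀ e ∈ l'.cycleEdges, e ∈ G.edgeSet) ∧
      l'.cycleEdges.countP Q ≤ l.cycleEdges.countP Q + 2 * b := by
  induction b generalizing l with
  | zero =>
    refine ⟨l, hl, hall, fun e he => ?_, le_rfl⟩
    have := List.countP_eq_zero.1 (Nat.le_zero.1 h) e he
    simpa using this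
  | succ b ih =>
    rcases Nat.eq_zero_or_pos (l.cycleEdges.countP (· ∉ G.edgeSet)) with h0 | h0
    · obtain ⟨l', h1, h2, h3, h4⟩ := ih l hl hall (by omega)
      exact ⟨l', h1, h2, h3, by omega⟩
    · obtain ⟨l₁, h1, h2, h3, h4⟩ := exists_cycleEdges_countP_lt G hG l hl hall h0
      obtain ⟨l', h1', h2', h3', h4'⟩ := ih l₁ h1 h2 (by omega)
      have := h4 Q
      exact ⟨l', h1', h2', h3', by omega⟩

theorem exists_walk_edges_eq_pathEdges {V : Type*} (G : SimpleGraph V) (a : V) (l : List V)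
    (h : ∀ e ∈ (a :: l).pathEdges, e ∈ G.edgeSet) :
    ∃ z, ∃ p : G.Walk a z, p.support = a :: l ∧ p.edges = (a :: l).pathEdges := by
  induction l generalizing a with
  | nil => exact ⟨a, .nil, by simp [List.pathEdges]⟩
  | cons b l ih =>
    rw [List.pathEdges] at h
    obtain ⟨z, p, h1, h2⟩ := ih b fun e he => h e (List.mem_cons_of_mem _ he)
    have hab : G.Adj a b := h s(a, b) List.mem_cons_self
    exact ⟨z, .cons hab p, by simp [h1], by simp [h2, List.pathEdges]⟩

theorem eq_head_of_mem_pathEdges {V : Type*} (a z : V) (l : List V) (ha : a ∉ l)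
    (h : s(z, a) ∈ (a :: l).pathEdges) : ∃ l', l = z :: l' := by
  obtain ⟨p, u, v, q, h1, h2⟩ := List.mem_of_mem_pathEdges h
  rcases p with _ | ⟨b, p⟩
  · simp only [List.nil_append, List.cons_append, List.cons.injEq] at h1
    obtain ⟨rfl, rfl⟩ := h1
    rcases Sym2.eq_iff.1 h2 with ⟨-, rfl⟩ | ⟨rfl, -⟩
    · simp at ha
    · exact ⟨q, rfl⟩
  · simp only [List.cons_append, List.cons.injEq] at h1
    exfalso
    rcases Sym2.eq_iff.1 h2 with ⟨-, rfl⟩ | ⟨-, rfl⟩ <;> simp [h1.2] at ha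

omit [DecidableRel G.Adj] in
/-- A closed polygon through all vertices whose edges lie in `G` is a Hamilton cycle. -/
theorem cycleEdges_mem_hamiltonCycles (l : List V) (hl : l.Nodup) (hall : ∀ v, v ∈ l)
    (h3 : 3 ≤ Fintype.card V) (hG : ∀ e ∈ l.cycleEdges, e ∈ G.edgeSet) :
    (l.cycleEdges.toFinset : Set (Sym2 V)) ∈ G.hamiltonCycles ∧
      l.cycleEdges.toFinset.card = Fintype.card V := by
  have hlen : l.length = Fintype.card V := by
    rw [← List.toFinset_card_of_nodup hl, ← Finset.card_univ]
    congr 1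
    ext v
    simp [hall v]
  rcases l with _ | ⟨a, m⟩
  · simp at hlen; omega
  rcases m.eq_nil_or_concat with rfl | ⟨m', z, hm⟩
  · simp at hlen; omega
  rw [List.concat_eq_append] at hm
  have hedges : (a :: m).cycleEdges = (a :: m).pathEdges ++ [s(z, a)] := by
    have : a :: m = (a :: m') ++ [z] := by rw [hm]; rfl
    rw [List.cycleEdges, this, List.pathEdges_concat_append_cons]
    rfl
  obtain ⟨z', p, hp1, hp2⟩ := exists_walk_edges_eq_pathEdges G a m fun e he =>
    hG e (by rw [hedges]; exact List.mem_append_left _ he)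
  have hzz : z' = z := by
    have h1 := p.getLast_support
    simp only [hp1] at h1
    rw [← h1]
    simp [hm]
  subst hzz
  have hadj : G.Adj z' a := hG s(z', a) (by rw [hedges]; simp)
  have hcyc : (SimpleGraph.Walk.cons hadj p).IsCycle := by
    rw [SimpleGraph.Walk.cons_isCycle_iff]
    refine ⟨by rw [SimpleGraph.Walk.isPath_def, hp1]; exact hl, fun hmem => ?_⟩
    rw [hp2] at hmem
    obtain ⟨l', hl'⟩ := eq_head_of_mem_pathEdges a z' m (List.nodup_cons.1 hl).1 hmem
    have hnd := (List.nodup_cons.1 hl).2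
    rcases l'.eq_nil_or_concat with rfl | ⟨l'', y, rfl⟩
    · rw [hl'] at hlen
      simp at hlen
      omega
    · rw [hl', List.concat_eq_append, ← List.cons_append] at hm
      have h1 := (List.append_inj' hm rfl).2
      rw [hl'] at hnd
      have : y = z' := by simpa using h1
      simp [this] at hnd
  have hlen' : (SimpleGraph.Walk.cons hadj p).length = Fintype.card V := by
    rw [SimpleGraph.Walk.length_cons, ← SimpleGraph.Walk.length_support, hp1, hlen]
  have hperm : ((SimpleGraph.Walk.cons hadj p).edges).Perm (a :: m).cycleEdges := by
    rw [SimpleGraph.Walk.edges_cons, hp2, hedges]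
    exact (List.perm_append_singleton _ _).symm
  refine ⟨⟨z', .cons hadj p, ?_, ?_⟩, ?_⟩
  · have := SimpleGraph.Walk.isHamiltonianCycle_iff_isCycle_and_length_eq.2 ⟨hcyc, hlen'⟩
    convert this
  · ext e
    simp only [Finset.mem_coe, List.mem_toFinset, Set.mem_ofPred_eq]
    exact hperm.mem_iff.symm
  · rw [← List.toFinset_eq_of_perm _ _ hperm,
      List.toFinset_card_of_nodup hcyc.isTrail.edges_nodup, SimpleGraph.Walk.length_edges, hlen']

end ListCycles

/-! ### Encoding cycle covers by Hamilton cycles. -/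

section Encoding

variable {V : Type*} [Fintype V] [DecidableEq V]

/-- The edges traversed by a permutation. -/
def permEdges (σ : Equiv.Perm V) : Finset (Sym2 V) :=
  Finset.univ.image fun v => s(v, σ v)

theorem mem_permEdges {σ : Equiv.Perm V} {e : Sym2 V} :
    e ∈ permEdges σ ↔ ∃ v, s(v, σ v) = e := by
  simp [permEdges]

theorem mem_pathEdges_iterate {V : Type*} (f : V → V) (m : ℕ) (v : V) (e : Sym2 V)
    (he : e ∈ (List.iterate f v m).pathEdges) :
    ∃ x ∈ List.iterate f v m, e = s(x, f x) := by
  induction m generalizing v with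
  | zero => simp [List.iterate, List.pathEdges] at he
  | succ m ih =>
    rcases m with _ | m
    · simp [List.iterate, List.pathEdges] at he
    · rw [List.iterate, List.iterate, List.pathEdges, List.mem_cons] at he
      rcases he with rfl | he
      · exact ⟨v, by simp [List.iterate], rfl⟩
      · obtain ⟨x, hx, rfl⟩ := ih (f v) he
        exact ⟨x, List.mem_cons_of_mem _ hx, rfl⟩

/-- The cycles are cut open and concatenated; only the joints can be foreign edges. -/
theorem exists_list_of_cycles (σ : Equiv.Perm V) (D : Finset (Equiv.Perm V))
    (hD : D ⊆ σ.cycleFactorsFinset) :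
    ∃ l : List V, l.Nodup ∧ l.toFinset = D.biUnion Equiv.Perm.support ∧
      l.pathEdges.countP (· ∉ permEdges σ) ≤ D.card := by
  induction D using Finset.induction_on with
  | empty => exact ⟨[], List.nodup_nil, by simp, by simp [List.pathEdges]⟩
  | insert c D hc ih =>
    have hcσ := hD (Finset.mem_insert_self c D)
    obtain ⟨l, h1, h2, h3⟩ := ih ((Finset.subset_insert c D).trans hD)
    obtain ⟨hcyc, hca⟩ := Equiv.Perm.mem_cycleFactorsFinset_iff.1 hcσ
    obtain ⟨v, hv, hw⟩ := hcyc.exists_toList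
    obtain ⟨hw1, hw2, -, -⟩ := hw _ rfl
    refine ⟨l ++ c.toList v, ?_, ?_, ?_⟩
    · refine h1.append hw1 ?_
      intro x hx hx'
      rw [← List.mem_toFinset, h2, Finset.mem_biUnion] at hx
      rw [← List.mem_toFinset, hw2] at hx'
      obtain ⟨d, hd, hxd⟩ := hx
      have hne : d ≠ c := fun h => hc (h ▸ hd)
      have hdisj := Equiv.Perm.cycleFactorsFinset_pairwise_disjoint σ
        (hD (Finset.mem_insert_of_mem hd)) hcσ hne
      exact Finset.disjoint_left.1 hdisj.disjoint_support hxd hx'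
    · rw [List.toFinset_append, h2, hw2, Finset.biUnion_insert, Finset.union_comm]
    · have h4 := List.countP_pathEdges_append_le (· ∉ permEdges σ) l (c.toList v)
      have h5 : (c.toList v).pathEdges.countP (· ∉ permEdges σ) = 0 := by
        rw [List.countP_eq_zero]
        intro e he
        obtain ⟨x, hx, rfl⟩ := mem_pathEdges_iterate _ _ _ _ he
        have hx' : x ∈ c.support := by
          rw [← hw2, List.mem_toFinset]
          exact hx
        simp only [decide_not, Bool.not_eq_eq_eq_not, Bool.not_true, decide_eq_false_iff_not,
          not_not]
        rw [hca x hx']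
        exact mem_permEdges.2 ⟨x, rfl⟩
      rw [Finset.card_insert_of_notMem hc]
      omega

/-- Every cycle cover of a Dirac graph is close to a Hamilton cycle. -/
theorem exists_hamiltonCycle_close (G : SimpleGraph V) [DecidableRel G.Adj]
    (hG : ∀ v, Fintype.card V ≤ 2 * G.degree v) (h3 : 3 ≤ Fintype.card V) (σ : Equiv.Perm V)
    (hσ : ∀ v, G.Adj v (σ v)) :
    ∃ C : Finset (Sym2 V), (C : Set (Sym2 V)) ∈ G.hamiltonCycles ∧
      (C \ permEdges σ).card ≤ 3 * (σ.cycleFactorsFinset.card + 1) ∧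
      (permEdges σ \ C).card ≤ 3 * (σ.cycleFactorsFinset.card + 1) := by
  set b := σ.cycleFactorsFinset.card + 1 with hb
  obtain ⟨l, h1, h2, h4⟩ := exists_list_of_cycles σ _ (Finset.Subset.refl _)
  have hall : ∀ v, v ∈ l := fun v => by
    rw [← List.mem_toFinset, h2, Finset.mem_biUnion]
    have hv : σ v ≠ v := (hσ v).ne'
    refine ⟨σ.cycleOf v, Equiv.Perm.cycleOf_mem_cycleFactorsFinset_iff.2
      (Equiv.Perm.mem_support.2 hv), ?_⟩
    rw [Equiv.Perm.mem_support_cycleOf_iff]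
    exact ⟨Equiv.Perm.SameCycle.refl _ _, Equiv.Perm.mem_support.2 hv⟩
  have h5 : l.cycleEdges.countP (· ∉ permEdges σ) ≤ b := by
    rcases l with _ | ⟨a, l⟩
    · simp [List.cycleEdges]
    · have := List.countP_pathEdges_append_le (· ∉ permEdges σ) (a :: l) [a]
      rw [List.cycleEdges]
      simp only [List.pathEdges, List.countP_nil] at this
      omega
  have h6 : l.cycleEdges.countP (· ∉ G.edgeSet) ≤ b := by
    refine (List.countP_mono_left fun e _ he => ?_).trans h5
    simp only [decide_eq_true_eq] at he ⊢
    intro he'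
    obtain ⟨v, rfl⟩ := mem_permEdges.1 he'
    exact he (hσ v)
  obtain ⟨l', h1', h2', h3', h4'⟩ :=
    exists_cycleEdges_subset G hG (· ∉ permEdges σ) b l h1 hall h6
  obtain ⟨hC, hCcard⟩ := cycleEdges_mem_hamiltonCycles G l' h1' h2' h3 h3'
  have hdiff : (l'.cycleEdges.toFinset \ permEdges σ).card ≤ 3 * b := by
    have : (l'.cycleEdges.toFinset \ permEdges σ) ⊆
        (l'.cycleEdges.filter (· ∉ permEdges σ)).toFinset := by
      intro e he
      simpa using he
    refine (Finset.card_le_card this).trans ((List.toFinset_card_le _).trans ?_)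
    rw [← List.countP_eq_length_filter]
    omega
  refine ⟨l'.cycleEdges.toFinset, hC, hdiff, ?_⟩
  -- The other difference is no larger: C has exactly n edges and σ has at most n, since a 2-cycle
  -- yields a single edge.
  have e1 := Finset.card_sdiff_add_card_inter l'.cycleEdges.toFinset (permEdges σ)
  have e2 := Finset.card_sdiff_add_card_inter (permEdges σ) l'.cycleEdges.toFinset
  have e3 : (permEdges σ).card ≤ Fintype.card V := Finset.card_image_le
  rw [Finset.inter_comm] at e2
  omega

/-- Undirected edges forget only the direction of each cycle, so agreement on one arc propagates
along its orbit: the next step must leave along the other edge, or go back in a 2-cycle. -/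
theorem perm_pow_apply_eq (σ τ : Equiv.Perm V) (h : permEdges σ = permEdges τ) (v : V)
    (hv : σ v = τ v) (m : ℕ) : (σ ^ m) v = (τ ^ m) v ∧ (σ ^ (m + 1)) v = (τ ^ (m + 1)) v := by
  have hor : ∀ σ τ : Equiv.Perm V, permEdges σ = permEdges τ → ∀ w, σ w = τ w ∨ τ (σ w) = w := by
    intro σ τ h w
    have : s(w, σ w) ∈ permEdges τ := h ▸ mem_permEdges.2 ⟨w, rfl⟩
    obtain ⟨x, hx⟩ := mem_permEdges.1 this
    rcases Sym2.eq_iff.1 hx with ⟨rfl, hx⟩ | ⟨rfl, hx⟩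
    · exact Or.inl hx.symm
    · exact Or.inr hx
  induction m with
  | zero => simpa using hv
  | succ m ih =>
    refine ⟨ih.2, ?_⟩
    obtain ⟨ih1, ih2⟩ := ih
    have e1 : σ ((σ ^ m) v) = (σ ^ (m + 1)) v := by rw [pow_succ', Equiv.Perm.mul_apply]
    have e2 : τ ((τ ^ m) v) = (τ ^ (m + 1)) v := by rw [pow_succ', Equiv.Perm.mul_apply]
    rw [pow_succ' σ (m + 1), pow_succ' τ (m + 1), Equiv.Perm.mul_apply, Equiv.Perm.mul_apply, ← ih2]
    set p := (σ ^ m) v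
    set w := (σ ^ (m + 1)) v
    rw [← ih1, ← ih2] at e2
    rcases hor σ τ h w with h1 | h1
    · exact h1
    · have h2 : σ w = p := τ.injective (h1.trans e2.symm)
      rcases hor τ σ h.symm w with h3 | h3
      · exact h3.symm
      · have h4 : τ w = p := σ.injective (h3.trans e1.symm)
        rw [h2, h4]

theorem exists_cycle_representatives (σ : Equiv.Perm V) (hσ : ∀ v, σ v ≠ v) :
    ∃ R : Finset (V × V), R.card ≤ σ.cycleFactorsFinset.card ∧ (∀ p ∈ R, σ p.1 = p.2) ∧
      ∀ v, ∃ p ∈ R, ∃ m : ℕ, (σ ^ m) p.1 = v := by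
  have h : ∀ c ∈ σ.cycleFactorsFinset, ∃ p : V × V, p.1 ∈ c.support ∧ σ p.1 = p.2 := by
    intro c hc
    obtain ⟨v, hv⟩ := (Equiv.Perm.mem_cycleFactorsFinset_iff.1 hc).1.nonempty_support
    exact ⟨(v, σ v), hv, rfl⟩
  choose f hf1 hf2 using h
  refine ⟨σ.cycleFactorsFinset.attach.image fun c => f c.1 c.2, ?_, ?_, ?_⟩
  · exact Finset.card_image_le.trans (Finset.card_attach).le
  · intro p hp
    obtain ⟨c, -, rfl⟩ := Finset.mem_image.1 hp
    exact hf2 c.1 c.2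
  · intro v
    have hc : σ.cycleOf v ∈ σ.cycleFactorsFinset :=
      Equiv.Perm.cycleOf_mem_cycleFactorsFinset_iff.2 (Equiv.Perm.mem_support.2 (hσ v))
    refine ⟨f _ hc, Finset.mem_image.2 ⟨⟨_, hc⟩, Finset.mem_attach _ _, rfl⟩, ?_⟩
    have h1 := hf1 _ hc
    rw [Equiv.Perm.mem_support_cycleOf_iff] at h1
    obtain ⟨m, -, hm⟩ := h1.1.symm.exists_pow_eq'
    exact ⟨m, hm⟩

theorem card_finset_card_le (α : Type*) [Fintype α] [DecidableEq α] (q : ℕ) :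
    (Finset.univ.filter fun s : Finset α => s.card ≤ q).card ≤ (Fintype.card α + 1) ^ q := by
  have : (Fintype.card α + 1) ^ q = (Finset.univ : Finset (Fin q → Option α)).card := by
    rw [Finset.card_univ]; simp
  rw [this]
  refine Finset.card_le_card_of_surjOn (fun f => Finset.univ.filter fun a => ∃ i, f i = some a) ?_
  intro s hs
  have hs : s.card ≤ q := by simpa using hs
  refine ⟨fun i => s.toList[i.1]?, by simp, ?_⟩
  ext a
  simp only [Finset.mem_filter, Finset.mem_univ, true_and]
  rw [← Finset.mem_toList, List.mem_iff_getElem?]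
  constructor
  · rintro ⟨i, hi⟩
    exact ⟨i.1, hi⟩
  · rintro ⟨i, hi⟩
    obtain ⟨hi', -⟩ := List.getElem?_eq_some_iff.1 hi
    rw [Finset.length_toList] at hi'
    exact ⟨⟨i, hi'.trans_le hs⟩, hi⟩

/-- In a Dirac graph there are few cycle covers with few cycles per Hamilton cycle. -/
theorem card_le_numHamiltonCycles_mul (G : SimpleGraph V) [DecidableRel G.Adj]
    (hG : ∀ v, Fintype.card V ≤ 2 * G.degree v) (h3 : 3 ≤ Fintype.card V) (s : ℕ)
    (F : Finset (Equiv.Perm V)) (hF : ∀ σ ∈ F, (∀ v, G.Adj v (σ v)) ∧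
      σ.cycleFactorsFinset.card ≤ s) :
    F.card ≤ G.numHamiltonCycles * (Fintype.card V ^ 2 + 1) ^ (9 * (s + 1)) := by
  classical
  set q := 3 * (s + 1) with hq
  -- The code is a Hamilton cycle, the edges to remove and to add, and one oriented arc per cycle:
  -- three sets of size at most q, hence the exponent 3q = 9(s + 1).
  have hcode : ∀ σ ∈ F, ∃ x : Set (Sym2 V) × Finset (Sym2 V) × Finset (Sym2 V) × Finset (V × V),
      x.1 ∈ G.hamiltonCycles ∧ x.2.1.card ≤ q ∧ x.2.2.1.card ≤ q ∧ x.2.2.2.card ≤ q ∧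
      (permEdges σ : Set (Sym2 V)) = x.1 \ x.2.1 ∪ x.2.2.1 ∧
      (∀ p ∈ x.2.2.2, σ p.1 = p.2) ∧ ∀ v, ∃ p ∈ x.2.2.2, ∃ m : ℕ, (σ ^ m) p.1 = v := by
    intro σ hσ
    obtain ⟨hadj, hs⟩ := hF σ hσ
    obtain ⟨C, hC, hC1, hC2⟩ := exists_hamiltonCycle_close G hG h3 σ hadj
    obtain ⟨R, hR1, hR2, hR3⟩ := exists_cycle_representatives σ fun v => (hadj v).ne'
    refine ⟨(C, C \ permEdges σ, permEdges σ \ C, R), hC, by simp only; omega, by simp only; omega,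
      by simp only; omega, ?_, hR2, hR3⟩
    simp only
    rw [← Finset.coe_sdiff, ← Finset.coe_union]
    congr 1
    ext e
    simp only [Finset.mem_union, Finset.mem_sdiff]
    tauto
  rcases F.eq_empty_or_nonempty with rfl | ⟨σ₀, hσ₀⟩
  · simp
  choose! φ hφ using hcode
  have hfin : G.hamiltonCycles.Finite := Set.toFinite _
  have hsym : Fintype.card (Sym2 V) ≤ Fintype.card V ^ 2 := by
    rw [sq, ← Fintype.card_prod]
    exact Fintype.card_le_of_surjective (fun p : V × V => s(p.1, p.2)) fun e => by
      induction e with | _ a b => exact ⟨(a, b), rfl⟩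
  set T := hfin.toFinset ×ˢ (Finset.univ.filter fun s : Finset (Sym2 V) => s.card ≤ q) ×ˢ
    (Finset.univ.filter fun s : Finset (Sym2 V) => s.card ≤ q) ×ˢ
    (Finset.univ.filter fun s : Finset (V × V) => s.card ≤ q) with hT
  have hinj : F.card ≤ T.card := by
    refine Finset.card_le_card_of_injOn φ ?_ ?_
    · intro σ hσ
      obtain ⟨h1, h2, h3, h4, -⟩ := hφ σ hσ
      simp [hT, h1, h2, h3, h4]
    · intro σ hσ τ hτ hστ
      obtain ⟨-, -, -, -, h5, h6, h7⟩ := hφ σ hσ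
      obtain ⟨-, -, -, -, h5', h6', -⟩ := hφ τ hτ
      rw [hστ] at h5 h6 h7
      have hE : permEdges σ = permEdges τ := Finset.coe_injective (h5.trans h5'.symm)
      ext v
      obtain ⟨p, hp, m, rfl⟩ := h7 v
      have h8 := perm_pow_apply_eq σ τ hE p.1 ((h6 p hp).trans (h6' p hp).symm) m
      have e1 : σ ((σ ^ m) p.1) = (σ ^ (m + 1)) p.1 := by rw [pow_succ', Equiv.Perm.mul_apply]
      have e2 : τ ((τ ^ m) p.1) = (τ ^ (m + 1)) p.1 := by rw [pow_succ', Equiv.Perm.mul_apply]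
      rw [e1, h8.2, ← e2, h8.1]
  have hS := (card_finset_card_le (Sym2 V) q).trans
    (Nat.pow_le_pow_left (Nat.add_le_add_right hsym 1) q)
  have hP := card_finset_card_le (V × V) q
  rw [Fintype.card_prod, ← sq] at hP
  refine hinj.trans ?_
  rw [hT, Finset.card_product, Finset.card_product, Finset.card_product,
    SimpleGraph.numHamiltonCycles, Set.ncard_eq_toFinset_card _ hfin,
    show 9 * (s + 1) = q + (q + q) by omega, pow_add, pow_add]
  exact Nat.mul_le_mul_left _ (Nat.mul_le_mul hS (Nat.mul_le_mul hS hP))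

/-- Cycles longer than ℓ have disjoint supports, so there are at most n/ℓ of them. -/
theorem card_cycleFactorsFinset_le (σ : Equiv.Perm V) (ℓ j : ℕ) (hℓ : 0 < ℓ)
    (h : (σ.cycleFactorsFinset.filter fun c => c.support.card ≤ ℓ).card ≤ j) :
    σ.cycleFactorsFinset.card ≤ j + Fintype.card V / ℓ := by
  have h1 := Finset.card_filter_add_card_filter_not (s := σ.cycleFactorsFinset)
    (fun c => c.support.card ≤ ℓ)
  have h2 : (σ.cycleFactorsFinset.filter fun c => ¬ c.support.card ≤ ℓ).card ≤
      Fintype.card V / ℓ := by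
    rw [Nat.le_div_iff_mul_le hℓ, ← smul_eq_mul]
    calc _ ≤ ∑ c ∈ σ.cycleFactorsFinset.filter fun c => ¬ c.support.card ≤ ℓ, c.support.card :=
          Finset.card_nsmul_le_sum _ _ _ fun c hc => (not_le.1 (Finset.mem_filter.1 hc).2).le
      _ ≤ ∑ c ∈ σ.cycleFactorsFinset, c.support.card :=
          Finset.sum_le_sum_of_subset (Finset.filter_subset _ _)
      _ = σ.cycleType.sum := by rw [Equiv.Perm.cycleType_def]; rfl
      _ = σ.support.card := Equiv.Perm.sum_cycleType σ
      _ ≤ Fintype.card V := Finset.card_le_univ _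
  omega

theorem card_partialCovers_le_hamilton (G : SimpleGraph V) [DecidableRel G.Adj]
    (hG : ∀ v, Fintype.card V ≤ 2 * G.degree v) (h3 : 3 ≤ Fintype.card V)
    (t : V → Finset V) (ht : ∀ v, t v ⊆ G.neighborFinset v) (ℓ j : ℕ) (hℓ : 0 < ℓ) :
    (partialCovers t Finset.univ).card ≤ (manyShortCycles t ℓ j).card + G.numHamiltonCycles *
      (Fintype.card V ^ 2 + 1) ^ (9 * (j + Fintype.card V / ℓ + 1)) := by
  have h1 := Finset.card_filter_add_card_filter_not (s := partialCovers t Finset.univ)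
    (fun σ => j ≤ (σ.cycleFactorsFinset.filter fun c => c.support.card ≤ ℓ).card)
  rw [← h1, manyShortCycles]
  refine Nat.add_le_add_left (card_le_numHamiltonCycles_mul G hG h3 _ _ fun σ hσ => ?_) _
  obtain ⟨h4, h5⟩ := Finset.mem_filter.1 hσ
  refine ⟨fun v => ?_, card_cycleFactorsFinset_le σ ℓ j hℓ (not_le.1 h5).le⟩
  exact (SimpleGraph.mem_neighborFinset _ _ _).1
    (ht v ((mem_partialCovers.1 h4).1 v (Finset.mem_univ v)))

end Encoding

/-! ### Choice of parameters and error terms. -/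

section Asymptotics

/-- With ℓ = m and j = m², the left side is at most (5m)^j e^(56m), while j! ≥ (m²/e)^j. The fifth
power keeps (jℓ)²/k = m⁶/k of order m. -/
theorem shortCycle_error_le (m n k : ℕ) (hm : 66 ≤ m) (h1 : m ^ 5 ≤ n) (h2 : n < (m + 1) ^ 5)
    (hk : n ≤ 5 * k) (hkn : k ≤ n) :
    ((n : ℝ) * m / k) ^ (m ^ 2) *
        Real.exp (((m ^ 2 * m : ℕ) : ℝ) ^ 2 / k + 2 * n / k * (1 + Real.log k)) ≤
      1 / 2 * ((m ^ 2).factorial : ℝ) := by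
  have hm' : (66 : ℝ) ≤ m := by exact_mod_cast hm
  have hn0 : 0 < n := lt_of_lt_of_le (by positivity) h1
  have hk0 : 0 < k := by omega
  have hk0' : (0 : ℝ) < k := by exact_mod_cast hk0
  have h1' : (m : ℝ) ^ 5 ≤ n := by exact_mod_cast h1
  have hk' : (n : ℝ) ≤ 5 * k := by exact_mod_cast hk
  have hA : (n : ℝ) * m / k ≤ 5 * m := by
    rw [div_le_iff₀ hk0']
    nlinarith
  have hlog : Real.log k ≤ 5 * m := by
    have e1 : (k : ℝ) ≤ ((m : ℝ) + 1) ^ 5 := by exact_mod_cast hkn.trans h2.le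
    calc Real.log k ≤ Real.log (((m : ℝ) + 1) ^ 5) := Real.log_le_log hk0' e1
      _ = 5 * Real.log ((m : ℝ) + 1) := by rw [Real.log_pow]; norm_num
      _ ≤ 5 * m := by
        have := Real.log_le_sub_one_of_pos (x := (m : ℝ) + 1) (by positivity)
        linarith
  have hlog0 : 0 ≤ Real.log k := Real.log_nonneg (by exact_mod_cast hk0)
  have hB : ((m ^ 2 * m : ℕ) : ℝ) ^ 2 / k + 2 * n / k * (1 + Real.log k) ≤ 56 * m := by
    have e1 : ((m ^ 2 * m : ℕ) : ℝ) ^ 2 / k ≤ 5 * m := by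
      rw [div_le_iff₀ hk0']
      push_cast
      calc ((m : ℝ) ^ 2 * m) ^ 2 = (m : ℝ) * (m : ℝ) ^ 5 := by ring
        _ ≤ (m : ℝ) * (5 * k) := mul_le_mul_of_nonneg_left (h1'.trans hk') (by positivity)
        _ = 5 * (m : ℝ) * k := by ring
    have e2 : 2 * (n : ℝ) / k ≤ 10 := by
      rw [div_le_iff₀ hk0']
      linarith
    have e3 : 2 * (n : ℝ) / k * (1 + Real.log k) ≤ 10 * (1 + 5 * m) :=
      mul_le_mul e2 (by linarith) (by linarith) (by norm_num)
    linarith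
  have hC := Real.pow_div_factorial_le_exp ((m : ℝ) ^ 2) (by positivity) (m ^ 2)
  rw [div_le_iff₀ (by positivity)] at hC
  have hD : 5 * Real.exp 2 ≤ m := by
    have e1 : Real.exp 2 = Real.exp 1 * Real.exp 1 := by rw [← Real.exp_add]; norm_num
    have e2 := Real.exp_one_lt_d9
    have e3 := Real.exp_pos 1
    rw [e1]
    nlinarith
  have hE : 2 * Real.exp (56 * m) ≤ Real.exp ((m : ℝ) ^ 2) := by
    have e1 : (2 : ℝ) ≤ Real.exp 1 := by have := Real.add_one_le_exp 1; linarith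
    calc 2 * Real.exp (56 * m) ≤ Real.exp 1 * Real.exp (56 * m) :=
          mul_le_mul_of_nonneg_right e1 (Real.exp_pos _).le
      _ = Real.exp (1 + 56 * m) := by rw [Real.exp_add]
      _ ≤ _ := Real.exp_le_exp.2 (by nlinarith)
  have hM : (0 : ℝ) < m := by linarith
  set M := m ^ 2 with hMdef
  have hMr : ((M : ℕ) : ℝ) = (m : ℝ) ^ 2 := by rw [hMdef]; push_cast; rfl
  have hpow : (5 * Real.exp 2) ^ M ≤ (m : ℝ) ^ M := pow_le_pow_left₀ (by positivity) hD M
  have hexp2 : Real.exp 2 ^ M = Real.exp ((m : ℝ) ^ 2) * Real.exp ((m : ℝ) ^ 2) := by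
    rw [← Real.exp_nat_mul, hMr, ← Real.exp_add]
    congr 1
    ring
  have hcancel : 0 < Real.exp ((m : ℝ) ^ 2) := Real.exp_pos _
  calc _ ≤ (5 * (m : ℝ)) ^ M * Real.exp (56 * m) :=
        mul_le_mul (pow_le_pow_left₀ (by positivity) hA M) (Real.exp_le_exp.2 hB)
          (Real.exp_pos _).le (by positivity)
    _ ≤ 1 / 2 * (M.factorial : ℝ) := by
      refine le_of_mul_le_mul_right ?_ hcancel
      calc (5 * (m : ℝ)) ^ M * Real.exp (56 * m) * Real.exp ((m : ℝ) ^ 2)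
          = (m : ℝ) ^ M * (5 ^ M * Real.exp ((m : ℝ) ^ 2)) * (1 / 2) *
              (2 * Real.exp (56 * m)) := by rw [mul_pow]; ring
        _ ≤ (m : ℝ) ^ M * (5 ^ M * Real.exp ((m : ℝ) ^ 2)) * (1 / 2) *
              Real.exp ((m : ℝ) ^ 2) := mul_le_mul_of_nonneg_left hE (by positivity)
        _ = (m : ℝ) ^ M * (5 * Real.exp 2) ^ M * (1 / 2) := by rw [mul_pow, hexp2]; ring
        _ ≤ (m : ℝ) ^ M * (m : ℝ) ^ M * (1 / 2) := by gcongr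
        _ = ((m : ℝ) ^ 2) ^ M * (1 / 2) := by rw [← mul_pow, ← sq]
        _ ≤ Real.exp ((m : ℝ) ^ 2) * (M.factorial : ℝ) * (1 / 2) := by gcongr
        _ = _ := by ring

/-- At most half of (k/e)^n covers have m² or more short cycles; the encoding bounds the number of
the others. -/
theorem dirac_hamilton_lower {V : Type*} [Fintype V] [DecidableEq V] [Nonempty V]
    (G : SimpleGraph V) [DecidableRel G.Adj]
    (hG : ∀ v, Fintype.card V ≤ 2 * G.degree v)
    (t : V → Finset V) (ht : ∀ v, t v ⊆ G.neighborFinset v) (k : ℕ)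
    (hout : ∀ v, (t v).card = k) (hin : ∀ w, (Finset.univ.filter fun v => w ∈ t v).card = k)
    (m : ℕ) (hm : 66 ≤ m) (h1 : m ^ 5 ≤ Fintype.card V) (h2 : Fintype.card V < (m + 1) ^ 5)
    (hk : Fintype.card V ≤ 5 * k) :
    ((k : ℝ) * Real.exp (-1)) ^ Fintype.card V ≤ 2 * (G.numHamiltonCycles *
      ((Fintype.card V : ℝ) ^ 2 + 1) ^ (9 * (m ^ 2 + Fintype.card V / m + 1))) := by
  obtain ⟨v₀⟩ := (inferInstance : Nonempty V)
  have hkn : k ≤ Fintype.card V := by rw [← hout v₀]; exact Finset.card_le_univ _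
  have hcard : 3 ≤ Fintype.card V := le_trans (by
    calc 3 ≤ 66 ^ 5 := by norm_num
      _ ≤ m ^ 5 := Nat.pow_le_pow_left hm 5) h1
  have hk0 : 0 < k := by omega
  have hmk : 2 * (m ^ 2 * m) ≤ k := by
    have e1 : 10 * (m ^ 2 * m) ≤ m ^ 5 := by
      calc 10 * (m ^ 2 * m) ≤ (m * m) * (m ^ 2 * m) := Nat.mul_le_mul_right _ (by nlinarith)
        _ = m ^ 5 := by ring
    omega
  have hlow := le_card_cycleCovers t k hout hin
  have hcov : (Finset.univ.filter fun σ : Equiv.Perm V => ∀ v, σ v ∈ t v) =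
      partialCovers t Finset.univ := by
    ext σ
    simp [partialCovers]
  rw [hcov] at hlow
  have hup := card_partialCovers_le_hamilton G hG hcard t ht m (m ^ 2) (by omega)
  have hbad := card_manyShortCycles_le t k hk0 hout hin m (m ^ 2) hmk
  have herr := shortCycle_error_le m (Fintype.card V) k hm h1 h2 hk hkn
  set D := ((k : ℝ) * Real.exp (-1)) ^ Fintype.card V with hD
  have hD0 : 0 ≤ D := by positivity
  have hbad' : ((manyShortCycles t m (m ^ 2)).card : ℝ) ≤ 1 / 2 * D := by
    have hf : (0 : ℝ) < ((m ^ 2).factorial : ℝ) := by positivity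
    refine le_of_mul_le_mul_right (hbad.trans ?_) hf
    calc _ = D * (((Fintype.card V : ℝ) * m / k) ^ (m ^ 2) *
        Real.exp (((m ^ 2 * m : ℕ) : ℝ) ^ 2 / k + 2 * Fintype.card V / k * (1 + Real.log k))) := by
          ring
      _ ≤ D * (1 / 2 * ((m ^ 2).factorial : ℝ)) := mul_le_mul_of_nonneg_left herr hD0
      _ = _ := by ring
  have hup' : ((partialCovers t Finset.univ).card : ℝ) ≤ (manyShortCycles t m (m ^ 2)).card +
      G.numHamiltonCycles *
        ((Fintype.card V : ℝ) ^ 2 + 1) ^ (9 * (m ^ 2 + Fintype.card V / m + 1)) := by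
    exact_mod_cast hup
  linarith

/-- The exponential rate of the loss in the number of Hamilton cycles. -/
noncomputable def hamiltonLoss (n : ℕ) : ℝ :=
  (Real.log 2 + 108 * (n : ℝ) ^ (4 / 5 : ℝ) * Real.log n) / n

theorem tendsto_hamiltonLoss : Tendsto hamiltonLoss atTop (𝓝 0) := by
  have h1 : Tendsto (fun n : ℕ => Real.log 2 / (n : ℝ)) atTop (𝓝 0) :=
    tendsto_const_nhds.div_atTop tendsto_natCast_atTop_atTop
  have h2 : Tendsto (fun x : ℝ => Real.log x / x ^ (1 / 5 : ℝ)) atTop (𝓝 0) :=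
    (isLittleO_log_rpow_atTop (by norm_num)).tendsto_div_nhds_zero
  have h3 := (h2.comp (tendsto_natCast_atTop_atTop (R := ℝ))).const_mul 108
  have h4 := h1.add h3
  rw [mul_zero, add_zero] at h4
  refine h4.congr' ?_
  filter_upwards [eventually_gt_atTop 0] with n hn
  have hn' : (0 : ℝ) < n := by exact_mod_cast hn
  have e1 : (n : ℝ) = (n : ℝ) ^ (4 / 5 : ℝ) * (n : ℝ) ^ (1 / 5 : ℝ) := by
    rw [← Real.rpow_add hn']
    norm_num
  have e2 : (n : ℝ) ^ (4 / 5 : ℝ) / n = 1 / (n : ℝ) ^ (1 / 5 : ℝ) := by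
    rw [div_eq_div_iff hn'.ne' (by positivity), one_mul]
    exact e1.symm
  simp only [Function.comp, hamiltonLoss, add_div]
  congr 1
  calc _ = 108 * Real.log n * (1 / (n : ℝ) ^ (1 / 5 : ℝ)) := by ring
    _ = _ := by rw [← e2]; ring

theorem loss_le (n m : ℕ) (hm : 66 ≤ m) (h1 : m ^ 5 ≤ n) (h2 : n < (m + 1) ^ 5) :
    2 * ((n : ℝ) ^ 2 + 1) ^ (9 * (m ^ 2 + n / m + 1)) ≤ Real.exp (hamiltonLoss n) ^ n := by
  have hm' : (66 : ℝ) ≤ m := by exact_mod_cast hm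
  have hn2 : 2 ≤ n := le_trans (by
    calc 2 ≤ 66 ^ 5 := by norm_num
      _ ≤ m ^ 5 := Nat.pow_le_pow_left hm 5) h1
  have hn2' : (2 : ℝ) ≤ n := by exact_mod_cast hn2
  have hn0 : (0 : ℝ) < n := by linarith
  set x : ℝ := (n : ℝ) ^ (1 / 5 : ℝ) with hx
  have hx5 : x ^ 5 = n := by
    rw [hx, ← Real.rpow_natCast, ← Real.rpow_mul hn0.le]
    norm_num
  have hx4 : x ^ 4 = (n : ℝ) ^ (4 / 5 : ℝ) := by
    rw [hx, ← Real.rpow_natCast, ← Real.rpow_mul hn0.le]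
    norm_num
  have hx0 : 0 ≤ x := by positivity
  have hmx : (m : ℝ) ≤ x := by
    refine le_of_pow_le_pow_left₀ (n := 5) (by norm_num) hx0 ?_
    rw [hx5]; exact_mod_cast h1
  have hxm : x ≤ m + 1 := by
    refine le_of_pow_le_pow_left₀ (n := 5) (by norm_num) (by positivity) ?_
    rw [hx5]; exact_mod_cast h2.le
  have hlogn : 0 ≤ Real.log n := Real.log_nonneg (by linarith)
  -- The constant 108 is 9 · 3 · 4: the exponent's factor 9, the bound n² + 1 ≤ n³, and this 4.
  have hexpo : ((m ^ 2 + n / m + 1 : ℕ) : ℝ) ≤ 4 * x ^ 4 := by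
    have e1 : ((n / m : ℕ) : ℝ) ≤ 2 * x ^ 4 := by
      refine Nat.cast_div_le.trans ?_
      rw [div_le_iff₀ (by linarith), ← hx5]
      have : x ≤ 2 * m := by linarith
      calc x ^ 5 = x ^ 4 * x := by ring
        _ ≤ x ^ 4 * (2 * m) := mul_le_mul_of_nonneg_left this (by positivity)
        _ = _ := by ring
    have hx1 : 1 ≤ x := by linarith
    have e2 : (m : ℝ) ^ 2 ≤ x ^ 4 := by
      calc (m : ℝ) ^ 2 ≤ x ^ 2 := by gcongr
        _ ≤ x ^ 4 := pow_le_pow_right₀ hx1 (by norm_num)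
    have e3 : 1 ≤ x ^ 4 := one_le_pow₀ hx1
    push_cast
    linarith
  have hbase : (n : ℝ) ^ 2 + 1 ≤ Real.exp (3 * Real.log n) := by
    have e1 : Real.exp (3 * Real.log n) = (n : ℝ) ^ 3 := by
      rw [mul_comm, ← Real.rpow_def_of_pos hn0]
      norm_cast
    rw [e1]
    nlinarith [sq_nonneg ((n : ℝ))]
  calc 2 * ((n : ℝ) ^ 2 + 1) ^ (9 * (m ^ 2 + n / m + 1))
      ≤ Real.exp (Real.log 2) * Real.exp (3 * Real.log n) ^ (9 * (m ^ 2 + n / m + 1)) := by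
        rw [Real.exp_log (by norm_num)]
        gcongr
    _ = Real.exp (Real.log 2 + 27 * Real.log n * ((m ^ 2 + n / m + 1 : ℕ) : ℝ)) := by
        rw [← Real.exp_nat_mul, ← Real.exp_add]
        congr 1
        rw [Nat.cast_mul]
        push_cast
        ring
    _ ≤ Real.exp (Real.log 2 + 27 * Real.log n * (4 * x ^ 4)) := by
        refine Real.exp_le_exp.2 (add_le_add_right (mul_le_mul_of_nonneg_left hexpo ?_) _)
        positivity
    _ = _ := by
        rw [← Real.exp_nat_mul, hamiltonLoss, mul_div_cancel₀ _ hn0.ne', hx4]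
        congr 1
        ring

end Asymptotics

/-! ### Conclusion: choice of the digraph and of the sequence ε. -/

theorem SimpleGraph.exists_regular_digraph_ge_reg {V : Type*} [Fintype V] [DecidableEq V]
    [Nonempty V] (G : SimpleGraph V) [DecidableRel G.Adj]
    (hG : ∀ v, Fintype.card V ≤ 2 * G.degree v) (hn : 12 ≤ Fintype.card V) :
    ∃ (k : ℕ) (t : V → Finset V), G.reg ≤ k ∧ Fintype.card V ≤ 5 * k ∧
      (∀ v, t v ⊆ G.neighborFinset v) ∧ (∀ v, (t v).card = k) ∧
      ∀ w, (Finset.univ.filter fun v => w ∈ t v).card = k := by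
  classical
  -- A small reg(G) is replaced by ⌊n/4⌋, which keeps the digraph dense; n ≥ 12 ensures 5⌊n/4⌋ ≥ n.
  rcases le_or_gt G.reg (Fintype.card V / 4) with h | h
  · obtain ⟨t, h1, h2, h3⟩ := exists_regular_digraph_of_dirac G hG (Fintype.card V / 4)
      (Nat.mul_div_le _ _)
    exact ⟨_, t, h, by omega, h1, h2, h3⟩
  · obtain ⟨H, hHG, hH⟩ := G.isGreatest_reg.1.2
    have hdeg : ∀ v, (H.neighborFinset v).card = G.reg := fun v => by
      rw [← hH v, ← SimpleGraph.card_neighborFinset_eq_degree]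
    refine ⟨G.reg, fun v => H.neighborFinset v, le_rfl, by omega, fun v w hw => ?_, hdeg,
      fun w => ?_⟩
    · rw [SimpleGraph.mem_neighborFinset] at hw ⊢
      exact hHG hw
    · rw [← hdeg w]
      congr 1
      ext v
      simp [H.adj_comm]

theorem proposition2p2 :
    ∃ ε : ℕ → ℝ, Tendsto ε atTop (𝓝 0) ∧
      ∀ (V : Type*) [Fintype V] [Nonempty V] (G : SimpleGraph V), G.IsDirac →
        ((G.reg : ℝ) / Real.exp 1) ^ Fintype.card V * (1 - ε (Fintype.card V)) ^ Fintype.card V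
          ≤ (G.numHamiltonCycles : ℝ) := by
  -- The value 1 makes the bound trivial for small n; for large n the factor (1 - ε)^n is exactly
  -- the inverse of the loss.
  refine ⟨fun n => if n < 66 ^ 5 then 1 else 1 - Real.exp (-hamiltonLoss n), ?_, ?_⟩
  · have h1 : Tendsto (fun n => 1 - Real.exp (-hamiltonLoss n)) atTop (𝓝 (1 - Real.exp (-0))) :=
      tendsto_const_nhds.sub ((Real.continuous_exp.tendsto _).comp tendsto_hamiltonLoss.neg)
    rw [neg_zero, Real.exp_zero, sub_self] at h1
    refine h1.congr' ?_
    filter_upwards [eventually_ge_atTop (66 ^ 5)] with n hn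
    rw [if_neg (not_lt.2 hn)]
  · intro V _ _ G hGD
    classical
    by_cases hn : Fintype.card V < 66 ^ 5
    · simp only [if_pos hn, sub_self]
      rw [zero_pow Fintype.card_ne_zero, mul_zero]
      exact Nat.cast_nonneg _
    simp only [if_neg hn]
    rw [sub_sub_cancel]
    rw [not_lt] at hn
    have hG : ∀ v, Fintype.card V ≤ 2 * G.degree v := by
      intro v
      have h1 := G.minDegree_le_degree v
      have h2 : (Fintype.card V : ℝ) / 2 ≤ (G.degree v : ℝ) := by
        refine hGD.trans ?_
        convert (Nat.cast_le (α := ℝ)).2 h1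
      have : (Fintype.card V : ℝ) ≤ 2 * G.degree v := by linarith
      exact_mod_cast this
    obtain ⟨k, t, hreg, hk, ht, hout, hin⟩ :=
      G.exists_regular_digraph_ge_reg hG (le_trans (by norm_num) hn)
    -- Here m is the integer part of the fifth root of n.
    obtain ⟨m, hm, h1, h2⟩ : ∃ m, 66 ≤ m ∧ m ^ 5 ≤ Fintype.card V ∧
        Fintype.card V < (m + 1) ^ 5 := by
      have hP : ∃ i, Fintype.card V < (i + 1) ^ 5 :=
        ⟨Fintype.card V, by
          calc Fintype.card V < Fintype.card V + 1 := Nat.lt_succ_self _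
            _ ≤ (Fintype.card V + 1) ^ 5 := Nat.le_self_pow (by norm_num) _⟩
      have hge : 66 ≤ Nat.find hP := by
        by_contra hlt
        have := Nat.find_spec hP
        have : Fintype.card V < 66 ^ 5 :=
          this.trans_le (Nat.pow_le_pow_left (by omega) 5)
        omega
      refine ⟨Nat.find hP, hge, ?_, Nat.find_spec hP⟩
      have := Nat.find_min hP (m := Nat.find hP - 1) (by omega)
      rwa [Nat.sub_add_cancel (by omega), not_lt] at this
    have hmain := dirac_hamilton_lower G hG t ht k hout hin m hm h1 h2 hk
    have hloss := loss_le (Fintype.card V) m hm h1 h2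
    set n := Fintype.card V
    have hexp : 0 < Real.exp (hamiltonLoss n) ^ n := by positivity
    have hreg' : ((G.reg : ℝ) / Real.exp 1) ^ n ≤ ((k : ℝ) * Real.exp (-1)) ^ n := by
      rw [Real.exp_neg, ← div_eq_mul_inv]
      have : (G.reg : ℝ) ≤ k := by exact_mod_cast hreg
      gcongr
    rw [Real.exp_neg, inv_pow, ← div_eq_mul_inv, div_le_iff₀ hexp]
    calc _ ≤ _ := hreg'.trans hmain
      _ = (G.numHamiltonCycles : ℝ) * (2 * ((n : ℝ) ^ 2 + 1) ^ (9 * (m ^ 2 + n / m + 1))) := by ring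
      _ ≤ _ := mul_le_mul_of_nonneg_left hloss (by positivity)
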